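/- Let $\mathsf X=\mathbb R^n$, $\mathsf Y=\mathbb R^p$ with $p\le n$, with Euclidean norms $|\cdot|$ and Borel $\sigma$-algebras. **Filtering model.** Let $f:\mathsf X\to\mathsf X$ be $a$-Lipschitz, and let $h:\mathsf X\to\mathsf Y$ be uniformly continuous, surjective and such that $|x_1-x_2|\le b_0+b|h(x_1)-h(x_2)|$ for all $x_1,x_2$ (condition (E1)). Let $v$ be a positive probability density on $\mathsf Y$ that is bounded, tends to $0$ at infinity and has a positive infimum on every compact set (E2). Let $q(x,\cdot)$, $x\in\mathsf X$, be probability densities on $\mathsf X$, jointly measurable, and $\psi$ a positive probability density on $\mathsf X$ with $\mu^-\psi(u)\le q(x,u)\le\mu^+\psi(u)$ for all $x,u$, for some constants $\mu^\pm>0$ (G). Put $Q(x,A)=\int_A q(x,x'-f(x))\,dx'$ and $g(x,y)=v(y-h(x))$. For a probability measure $\nu$ on $\mathsf X$ and $y_{0:N}\in\mathsf Y^{N+1}$ let $$\phi_{\nu,N}[y_{0:N}](A)=\frac{\int\nu(dx_0)g(x_0,y_0)\prod_{i=1}^N Q(x_{i-1},dx_i)g(x_i,y_i)\,\mathbb 1_A(x_N)}{\int\nu(dx_0)g(x_0,y_0)\prod_{i=1}^N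 Q(x_{i-1},dx_i)g(x_i,y_i)} .$$ For $\Delta>0$ let $C(y,\Delta)=\{x\in\mathsf X:|h(x)-y|\le\Delta\}$, and let $q^-(r)=\mu^-\inf_{|u|\le r}\psi(u)$. **Observations.** Let $X_k^*=f^*(X_{k-1}^*)+\zeta_k^*$ for $k\ge1$ and $Y_k^*=h^*(X_k^*)+\varepsilon_k^*$ for $k\ge0$, where $f^*$ is $a^*$-Lipschitz; $h^*$ is measurable and surjective with $|x_1-x_2|\le b_0^*+b^*|h^*(x_1)-h^*(x_2)|$ for some $b_0^*,b^*>0$; the $\varepsilon_k^*$ are i.i.d.; for $k\ge1$, $\zeta_k^*$ is independent of $\varepsilon_k^*$ and, conditionally on $X_{k-1}^*=x$, has a density $q^*(x,\cdot)$ with $\mu_-^*\psi^*(u)\le q^*(x,u)\le\mu_+^*\psi^*(u)$ for a probability density $\psi^*$ and constants $\mu^*_\pm>0$. Moreover $\zeta_k^*=g^*(X_{k-1}^*,A_k^*)$ for $k\ge 1$, where $g^*$ is measurable and $(A_k^*)_{k\ge0}$ is a sequence of i.i.d. uniform variables on $(0,1)$, independent of the sequence $(\varepsilon_k^*)_{k\ge0}$.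 Assume: * (O1) $\|f-f^*\|_\infty<\infty$ and $\|h-h^*\|_\infty<\infty$; * (O3) there is a measurable $g_+^*$ with $|g^*(x,\alpha)|\le g_+^*(\alpha)$ for all $x\in\mathsf X$, $\alpha\in(0,1)$; * (O4) for every $\Delta>0$ there is $\tau>0$ such that $\log\mathbb E[e^{\lambda Z^{*\Delta}_1}]<\infty$ for all $\lambda\in[0,\tau)$, where $$Z_1^{*\Delta}=-\log q^-\big[(a+1)b_0+(a+1)b\Delta+\kappa+2a^*b^*+a^*b^*|\varepsilon_0^*|+b^*|\varepsilon_1^*|+g_+^*(A_1^*)\big]$$ (equal to $+\infty$ where $q^-$ vanishes) and $\kappa=\|f-f^*\|_\infty+(b_0+b\|h^*-h\|_\infty)(1+a^*)$. **Conclusion.** Let $\nu,\nu'$ be probability measures on $\mathsf X$ and let $\Delta>0$ be such that, for some $\lambda>0$ (with $[u]_-=\max(-u,0)$ and $\log 0=-\infty$), $$\mathbb E\exp\Big(\lambda\Big[\log\int\nu(dx)\,g(x,Y_0^*)\,Q(x,C(Y_1^*,\Delta))\Big]_-\Big)<\infty,\qquad \mathbb E\exp\Big(\lambda\Big[\log\int\nu'(dx)\,g(x,Y_0^*)\,Q(x,C(Y_1^*,\Delta))\Big]_-\Big)<\infty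 .$$ Then $$\limsup_{N\to\infty}\frac1N\log\mathbb E\Big[\big\|\phi_{\nu,N}[Y^*_{0:N}]-\phi_{\nu',N}[Y^*_{0:N}]\big\|_{\mathrm{TV}}\Big]<0,$$ where $\|\mu_1-\mu_2\|_{\mathrm{TV}}=\sup_{A}|\mu_1(A)-\mu_2(A)|$ over Borel sets $A$. -/

import Mathlib

open MeasureTheory ProbabilityTheory Filter Topology
open scoped NNReal ENNReal

namespace FilterForgetting

/-- Euclidean space `ℝⁿ` with the Euclidean norm. -/
abbrev Euc (n : ℕ) : Type := EuclideanSpace ℝ (Fin n)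

/-- A measurable probability density with respect to Lebesgue measure on `ℝⁿ`. -/
structure IsProbDensity {n : ℕ} (φ : Euc n → ℝ) : Prop where
  measurable : Measurable φ
  nonneg : ∀ u, 0 ≤ φ u
  lintegral_eq_one : ∫⁻ u, ENNReal.ofReal (φ u) = 1

/-- A measurable family `u ↦ q x u` of probability densities on `ℝⁿ`, indexed by `x ∈ ℝⁿ`. -/
structure IsTransitionDensity {n : ℕ} (q : Euc n → Euc n → ℝ) : Prop where
  measurable : Measurable (Function.uncurry q)
  nonneg : ∀ x u, 0 ≤ q x u
  lintegral_eq_one : ∀ x, ∫⁻ u, ENNReal.ofReal (q x u) = 1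

/-- `μm ψ(u) ≤ q(x,u) ≤ μp ψ(u)` with positive constants `μm`, `μp`. -/
structure IsComparable {n : ℕ} (q : Euc n → Euc n → ℝ) (ψ : Euc n → ℝ) (μm μp : ℝ) : Prop where
  lower_pos : 0 < μm
  upper_pos : 0 < μp
  lower_le : ∀ x u, μm * ψ u ≤ q x u
  le_upper : ∀ x u, q x u ≤ μp * ψ u

noncomputable section

/-! ### The filter -/

section Filter

variable {X Y : Type*} [MeasurableSpace X]

/-- The unnormalized filter: the measure
`A ↦ ∫ ν(dx₀) g(x₀,y₀) ∏_{i=1}^n Q(x_{i-1},dx_i) g(x_i,y_i) 1_A(x_n)`. -/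
def unnormalizedFilter (Q : Kernel X X) (g : X → Y → ℝ≥0∞) (ν : Measure X) (y : ℕ → Y) :
    ℕ → Measure X
  | 0 => ν.withDensity fun x => g x (y 0)
  | k + 1 => ((unnormalizedFilter Q g ν y k).bind Q).withDensity fun x => g x (y (k + 1))

/-- The filter `φ_{ν,n}[y_{0:n}]`. It depends on `y` through `y 0, …, y n` only. -/
def filterMeasure (Q : Kernel X X) (g : X → Y → ℝ≥0∞) (ν : Measure X) (n : ℕ) (y : ℕ → Y) :
    Measure X :=
  (unnormalizedFilter Q g ν y n Set.univ)⁻¹ • unnormalizedFilter Q g ν y n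

/-- Total variation distance `sup_A |μ₁(A) - μ₂(A)|` of two finite measures. -/
def tvDist (μ₁ μ₂ : Measure X) : ℝ≥0∞ :=
  ⨆ (A : Set X) (_ : MeasurableSet A), ENNReal.ofReal |μ₁.real A - μ₂.real A|

/-- `ν g(·,y₀) Q 1_C = ∫ ν(dx) g(x,y₀) Q(x,C)`. -/
def initialMass (Q : Kernel X X) (g : X → Y → ℝ≥0∞) (ν : Measure X) (C : Set X) (y₀ : Y) :
    ℝ≥0∞ :=
  ∫⁻ x, g x y₀ * Q x C ∂ν

end Filter

/-! ### Log-moment generating function -/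

/-- `log E[exp (t Z)]` for an extended-real random variable `Z`, as an element of `[-∞, ∞]`. -/
def logMGF {Ω : Type*} [MeasurableSpace Ω] (P : Measure Ω) (Z : Ω → EReal) (t : ℝ) : EReal :=
  ENNReal.log (∫⁻ ω, EReal.exp ((t : EReal) * Z ω) ∂P)

/-- `E[exp (t [log Z]_-)]` for a `[0,∞]`-valued random variable `Z`; here `[u]_- = max (-u) 0`,
and the integrand is `+∞` where `Z = 0` (if `t > 0`). -/
def negLogMoment {Ω : Type*} [MeasurableSpace Ω] (P : Measure Ω) (Z : Ω → ℝ≥0∞) (t : ℝ) : ℝ≥0∞ :=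
  ∫⁻ ω, EReal.exp ((t : EReal) * max (-ENNReal.log (Z ω)) 0) ∂P

/-! ### The filtering model -/

/-- The law with density `q x ·`, as a kernel. -/
def noiseKernel {n : ℕ} (q : Euc n → Euc n → ℝ) : Kernel (Euc n) (Euc n) :=
  Kernel.withDensity (Kernel.const (Euc n) volume) fun x u => ENNReal.ofReal (q x u)

/-- The transition kernel `Q(x,A) = ∫_A q(x, x' - f x) dx'` of the state process
`X_k = f(X_{k-1}) + ζ_k`, where `ζ_k` has density `q x ·` given `X_{k-1} = x`. -/
def stateKernel {n : ℕ} (f : Euc n → Euc n) (q : Euc n → Euc n → ℝ) : Kernel (Euc n) (Euc n) :=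
  Kernel.withDensity (Kernel.const (Euc n) volume) fun x x' => ENNReal.ofReal (q x (x' - f x))

/-- The likelihood `g(x,y) = v(y - h x)` of the observation `Y_k = h(X_k) + ε_k`. -/
def likelihood {n p : ℕ} (h : Euc n → Euc p) (v : Euc p → ℝ) (x : Euc n) (y : Euc p) : ℝ≥0∞ :=
  ENNReal.ofReal (v (y - h x))

/-- The set `C(y,Δ) = {x : |h x - y| ≤ Δ}`. -/
def doeblinSet {n p : ℕ} (h : Euc n → Euc p) (y : Euc p) (Δ : ℝ) : Set (Euc n) :=
  {x | ‖h x - y‖ ≤ Δ}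

/-- Condition (E1). -/
structure CondE1 {n p : ℕ} (f : Euc n → Euc n) (h : Euc n → Euc p) (a : ℝ≥0) (b₀ b : ℝ) :
    Prop where
  lipschitz : LipschitzWith a f
  uniformContinuous : UniformContinuous h
  surjective : Function.Surjective h
  inverse : ∀ x₁ x₂, ‖x₁ - x₂‖ ≤ b₀ + b * ‖h x₁ - h x₂‖

/-- Condition (E2), together with the requirement that `v` is a positive density. -/
structure CondE2 {p : ℕ} (v : Euc p → ℝ) : Prop where
  density : IsProbDensity v
  pos : ∀ u, 0 < v u
  bounded : ∃ M, ∀ u, v u ≤ M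
  tendsto_zero : Tendsto v (cocompact (Euc p)) (𝓝 0)
  inf_pos : ∀ K : Set (Euc p), IsCompact K → ∃ c > 0, ∀ u ∈ K, c ≤ v u

/-- Condition (G) on the state noise density of the filtering model. -/
structure CondG {n : ℕ} (q : Euc n → Euc n → ℝ) (ψ : Euc n → ℝ) (μm μp : ℝ) : Prop where
  transition : IsTransitionDensity q
  density : IsProbDensity ψ
  pos : ∀ u, 0 < ψ u
  comparable : IsComparable q ψ μm μp

/-- `q⁻(r) = μ⁻ inf_{|u| ≤ r} ψ(u)`. -/
def qMinus {n : ℕ} (μm : ℝ) (ψ : Euc n → ℝ) (r : ℝ) : ℝ :=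
  μm * ⨅ u : Metric.closedBall (0 : Euc n) r, ψ u

/-! ### The process producing the observations -/

/-- The state-space system
`X_k = f(X_{k-1}) + ζ_k` for `k ≥ 1`, `Y_k = h(X_k) + ε_k` for `k ≥ 0`, with state noise
`ζ_k = γ(X_{k-1}, A_k)` for `k ≥ 1`: the `A_k` are i.i.d. uniform on `(0,1)`, the `ε_k` are i.i.d.,
the sequences `A` and `ε` are independent of each other, `ζ_k` is independent of `ε_k` for
`k ≥ 1`, and `ζ_k` has density `q x ·` given `X_{k-1} = x`, where `q` is comparable to a
density `ψ`. The values `ζ 0` and `A 0` play no role. -/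
structure ObservationSystem {n p : ℕ} {Ω : Type*} [MeasurableSpace Ω] (P : Measure Ω)
    [IsProbabilityMeasure P] (f : Euc n → Euc n) (h : Euc n → Euc p) (a : ℝ≥0) (b₀ b : ℝ)
    (q : Euc n → Euc n → ℝ) (ψ : Euc n → ℝ) (μm μp : ℝ) (γ : Euc n → ℝ → Euc n)
    (X ζ : ℕ → Ω → Euc n) (Y ε : ℕ → Ω → Euc p) (A : ℕ → Ω → ℝ) : Prop where
  lipschitz : LipschitzWith a f
  measurable_h : Measurable h
  surjective : Function.Surjective h
  inv_const_pos : 0 < b₀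
  inv_slope_pos : 0 < b
  inverse : ∀ x₁ x₂, ‖x₁ - x₂‖ ≤ b₀ + b * ‖h x₁ - h x₂‖
  transition : IsTransitionDensity q
  density : IsProbDensity ψ
  comparable : IsComparable q ψ μm μp
  measurable_noise_map : Measurable (Function.uncurry γ)
  measurable_X : ∀ k, Measurable (X k)
  measurable_ζ : ∀ k, Measurable (ζ k)
  measurable_ε : ∀ k, Measurable (ε k)
  measurable_A : ∀ k, Measurable (A k)
  state_eq : ∀ k ω, X (k + 1) ω = f (X k ω) + ζ (k + 1) ω
  obs_eq : ∀ k ω, Y k ω = h (X k ω) + ε k ω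
  noise_eq : ∀ k, ∀ᵐ ω ∂P, ζ (k + 1) ω = γ (X k ω) (A (k + 1) ω)
  noise_law : ∀ k, condDistrib (ζ (k + 1)) (X k) P =ᵐ[P.map (X k)] noiseKernel q
  noise_indep : ∀ k, IndepFun (ζ (k + 1)) (ε (k + 1)) P
  ε_indep : iIndepFun ε P
  ε_ident : ∀ k, IdentDistrib (ε k) (ε 0) P P
  A_indep : iIndepFun A P
  A_uniform : ∀ k, pdf.IsUniform (A k) (Set.Ioo 0 1) P
  A_indep_ε : IndepFun (fun ω k => A k ω) (fun ω k => ε k ω) P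

/-- The supremum norm `‖φ₁ - φ₂‖_∞`, meaningful when the difference is bounded. -/
def supDist {n m : ℕ} (φ₁ φ₂ : Euc n → Euc m) : ℝ := ⨆ x, ‖φ₁ x - φ₂ x‖

/-- Condition (O1): `‖f - fs‖_∞ < ∞` and `‖h - hs‖_∞ < ∞`. -/
structure CondO1 {n p : ℕ} (f fs : Euc n → Euc n) (h hs : Euc n → Euc p) : Prop where
  state : BddAbove (Set.range fun x => ‖f x - fs x‖)
  obs : BddAbove (Set.range fun x => ‖h x - hs x‖)

/-- Condition (O3): `|γ(x,α)| ≤ γp(α)` for `α ∈ (0,1)`, with `γp` measurable. -/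
structure CondO3 {n : ℕ} (γ : Euc n → ℝ → Euc n) (γp : ℝ → ℝ) : Prop where
  measurable : Measurable γp
  bound : ∀ x, ∀ α ∈ Set.Ioo (0 : ℝ) 1, ‖γ x α‖ ≤ γp α

/-- `κ = ‖f - fs‖_∞ + (b₀ + b ‖hs - h‖_∞) (1 + as)`. -/
def kappa {n p : ℕ} (f fs : Euc n → Euc n) (h hs : Euc n → Euc p) (b₀ b : ℝ) (as : ℝ≥0) : ℝ :=
  supDist f fs + (b₀ + b * supDist hs h) * (1 + as)

/-- `-log q⁻(c + d Δ + κ + 2 as bs + as bs |e₀| + bs |e₁| + s)` with `c = (a+1) b₀` and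
`d = (a+1) b`. The value is `+∞` where `q⁻` vanishes. -/
def zStar {n p : ℕ} (μm : ℝ) (ψ : Euc n → ℝ) (a : ℝ≥0) (b₀ b κ : ℝ) (as : ℝ≥0) (bs Δ : ℝ)
    (e₀ e₁ : Euc p) (s : ℝ) : EReal :=
  -ENNReal.log (ENNReal.ofReal (qMinus μm ψ
    ((a + 1) * b₀ + (a + 1) * b * Δ + κ + 2 * as * bs + as * bs * ‖e₀‖ + bs * ‖e₁‖ + s)))

end

end FilterForgetting

open FilterForgetting

open FilterForgetting

/-! The difference of the two filters on a set is a ratio. The denominator is the product of the two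
total masses. The numerator is an antisymmetric integral over pairs of trajectories under the
product dynamics. If both components move from `C(Y_k, D)` to `C(Y_{k+1}, D)` and the transition
density is at least `c₀` there, the product density contains a part `c₀ ^ 2` symmetric in the
arrival pair, which antisymmetry cancels. Where the densities are also at most `M`, the rest is at
most `ρ = 1 - c₀ ^ 2 / M ^ 2` times the product density (`coupling_step`, iterated in
`backward_mul_le_add_pairBackward`). No Doeblin condition on a fixed set is needed, since the sets
follow the observations.

Each of the `n` transitions of a pair is coupled, or inactive (the observation noises push the
density bound below `c₀`), or bad (some component lies outside its set, or some density exceeds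
`M`). One of the three kinds must be frequent, which bounds the numerator by three terms
(`pow_mul_pairBackward_le`). Frequent coupling costs `r ^ n` with `r < 1`, relative to the masses.
Frequent inactivity is rare under the law of the noises, once `c₀` is small. Frequent bad
transitions are charged `θ ^ 2` each, and the resulting term is `V ^ 2 * (2 * V) ^ (2 * n) / θ ^ n`
with `V` independent of `θ`: the decay of `v` absorbs exits once `D` is large, and integrability of
`ψ` absorbs large densities once `M` is large.

Only the last term has to be compared with the masses. Keeping the trajectories in the sets of
radius `Δ` bounds each mass below by an initial factor, a geometric factor and a product of link
bounds `q⁻(…)` (`initialMass_mul_le_unnormalizedFilter`). As the distance is at most `1`, a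
fractional power `s` of the ratio suffices, and its expectation grows at a finite geometric rate by
(O4) and one-dependence of the link bounds (`lintegral_prod_one_dependent_le`). That rate involves
only `Δ`, `V` and `s`, so `θ` can be chosen to beat it; then `D` and `M`, then `c₀`, then `r` follow
without circularity. -/

namespace FilterForgetting

noncomputable section

/-! ### Backward operators -/

section Backward

variable {X : Type*} [MeasurableSpace X]

/-- The backward operator
`φ ↦ ∫ ∏_{i=k+1}^{k+m} p(x_{i-1},x_i) G_i(x_i) φ(x_{k+m}) μ(dx_{k+1}) ⋯ μ(dx_{k+m})`. -/
def backward (μ : Measure X) (p : X → X → ℝ≥0∞) (G : ℕ → X → ℝ≥0∞) :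
    ℕ → ℕ → (X → ℝ≥0∞) → X → ℝ≥0∞
  | _, 0, φ => φ
  | k, m + 1, φ => fun x => ∫⁻ z, p x z * (G (k + 1) z * backward μ p G (k + 1) m φ z) ∂μ

variable {μ : Measure X} [SFinite μ] {p : X → X → ℝ≥0∞} {G : ℕ → X → ℝ≥0∞}

lemma measurable_backward (hp : Measurable (Function.uncurry p)) (hG : ∀ k, Measurable (G k))
    {φ : X → ℝ≥0∞} (hφ : Measurable φ) (k m : ℕ) : Measurable (backward μ p G k m φ) := by
  induction m generalizing k with
  | zero => exact hφ
  | succ m ih =>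
    refine Measurable.lintegral_prod_right' (f := fun xz : X × X =>
      p xz.1 xz.2 * (G (k + 1) xz.2 * backward μ p G (k + 1) m φ xz.2)) ?_
    exact hp.mul (((hG _).comp measurable_snd).mul ((ih _).comp measurable_snd))

omit [SFinite μ] in
lemma lintegral_kernel_eq {Q : Kernel X X} (hp : Measurable (Function.uncurry p))
    (hQ : ∀ x, Q x = μ.withDensity (p x)) {φ : X → ℝ≥0∞} (hφ : Measurable φ) (x : X) :
    ∫⁻ z, φ z ∂(Q x) = ∫⁻ z, p x z * φ z ∂μ := by
  rw [hQ, lintegral_withDensity_eq_lintegral_mul _ (hp.of_uncurry_left) hφ]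
  rfl

/-- Duality between the unnormalized filter and the backward operator. -/
lemma lintegral_unnormalizedFilter {Y : Type*} {Q : Kernel X X} {g : X → Y → ℝ≥0∞} {y : ℕ → Y}
    (hp : Measurable (Function.uncurry p))
    (hQ : ∀ x, Q x = μ.withDensity (p x)) (hg : ∀ k, Measurable fun x => g x (y k))
    {φ : X → ℝ≥0∞} (hφ : Measurable φ) (ν : Measure X) (k m : ℕ) :
    ∫⁻ x, φ x ∂(unnormalizedFilter Q g ν y (k + m)) =
      ∫⁻ x, backward μ p (fun k x => g x (y k)) k m φ x ∂(unnormalizedFilter Q g ν y k) := by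
  induction m generalizing k with
  | zero => rfl
  | succ m ih =>
    have hm := measurable_backward (μ := μ) hp hg hφ (k + 1) m
    rw [show k + (m + 1) = k + 1 + m by ring, ih, unnormalizedFilter,
      lintegral_withDensity_eq_lintegral_mul _ (hg _) hm,
      Measure.lintegral_bind Q.measurable.aemeasurable ((hg _).mul hm).aemeasurable]
    refine lintegral_congr fun x => ?_
    rw [lintegral_kernel_eq hp hQ ((hg _).mul hm)]
    rfl

lemma lintegral_unnormalizedFilter_zero {Y : Type*} {Q : Kernel X X} {g : X → Y → ℝ≥0∞} {y : ℕ → Y}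
    (hp : Measurable (Function.uncurry p))
    (hQ : ∀ x, Q x = μ.withDensity (p x)) (hg : ∀ k, Measurable fun x => g x (y k))
    {φ : X → ℝ≥0∞} (hφ : Measurable φ) (ν : Measure X) (n : ℕ) :
    ∫⁻ x, φ x ∂(unnormalizedFilter Q g ν y n) =
      ∫⁻ x, g x (y 0) * backward μ p (fun k x => g x (y k)) 0 n φ x ∂ν := by
  have h := lintegral_unnormalizedFilter (μ := μ) hp hQ hg hφ ν 0 n
  rw [zero_add] at h
  rw [h, unnormalizedFilter, lintegral_withDensity_eq_lintegral_mul _ (hg _)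
    (measurable_backward hp hg hφ 0 n)]
  rfl

omit [SFinite μ] in
lemma backward_le {V : ℝ≥0∞} (hV : ∀ k x, G k x ≤ V) (hp1 : ∀ x, ∫⁻ z, p x z ∂μ ≤ 1)
    {φ : X → ℝ≥0∞} (hφ : ∀ x, φ x ≤ 1) (hp : Measurable (Function.uncurry p)) (k m : ℕ) (x : X) :
    backward μ p G k m φ x ≤ V ^ m := by
  induction m generalizing k x with
  | zero => simpa [backward] using hφ x
  | succ m ih =>
    calc backward μ p G k (m + 1) φ x ≤ ∫⁻ z, p x z * (V * V ^ m) ∂μ := by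
          refine lintegral_mono fun z => ?_
          gcongr
          exacts [hV _ _, ih _ _]
      _ = (∫⁻ z, p x z ∂μ) * (V * V ^ m) := lintegral_mul_const _ hp.of_uncurry_left
      _ ≤ V ^ (m + 1) := by
          rw [pow_succ']
          exact mul_le_of_le_one_left' (hp1 x)

omit [SFinite μ] in
/-- Lower bound of the backward operator along sets on which the dynamics is minorized. -/
lemma le_backward_one {C : ℕ → Set X} {l : ℕ → ℝ≥0∞} {w c : ℝ≥0∞}
    (hC : ∀ k, MeasurableSet (C k))
    (hG : ∀ k, ∀ x ∈ C k, w ≤ G k x) (hc : ∀ k, c ≤ μ (C k))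
    (hl : ∀ k, ∀ x ∈ C k, ∀ z ∈ C (k + 1), l k ≤ p x z) (k m : ℕ) (x : X) (hx : x ∈ C k) :
    (w * c) ^ m * ∏ i ∈ Finset.range m, l (k + i) ≤ backward μ p G k m (fun _ => 1) x := by
  induction m generalizing k x with
  | zero => simp [backward]
  | succ m ih =>
    set D : ℝ≥0∞ := (w * c) ^ m * ∏ i ∈ Finset.range m, l (k + 1 + i)
    have h1 : ∏ i ∈ Finset.range (m + 1), l (k + i)
        = (∏ i ∈ Finset.range m, l (k + 1 + i)) * l k := by
      rw [Finset.prod_range_succ']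
      simp only [add_assoc, add_comm 1, add_zero]
    calc (w * c) ^ (m + 1) * ∏ i ∈ Finset.range (m + 1), l (k + i)
        = (l k * (w * D)) * c := by rw [h1, pow_succ]; simp only [D]; ring
      _ ≤ (l k * (w * D)) * μ (C (k + 1)) := by gcongr; exact hc _
      _ = ∫⁻ z in C (k + 1), l k * (w * D) ∂μ := by rw [setLIntegral_const]
      _ ≤ ∫⁻ z in C (k + 1), p x z * (G (k + 1) z * backward μ p G (k + 1) m (fun _ => 1) z) ∂μ := by
          refine setLIntegral_mono' (hC _) fun z hz => ?_
          gcongr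
          exacts [hl k x hx z hz, hG _ z hz, ih _ z hz]
      _ ≤ backward μ p G k (m + 1) (fun _ => 1) x := setLIntegral_le_lintegral _ _

/-- The first transition is only required to land in `C 1`, which produces `initialMass`;
confinement to the sets starts from there. `C 0` plays no role in the bound, so `ν` need not charge
it. -/
lemma initialMass_mul_le_unnormalizedFilter {Y : Type*} {Q : Kernel X X} {g : X → Y → ℝ≥0∞}
    {y : ℕ → Y} (hp : Measurable (Function.uncurry p))
    (hQ : ∀ x, Q x = μ.withDensity (p x)) (hg : ∀ k, Measurable fun x => g x (y k))
    {C : ℕ → Set X} {l : ℕ → ℝ≥0∞} {w c : ℝ≥0∞} (hC : ∀ k, MeasurableSet (C k))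
    (hG : ∀ k, ∀ x ∈ C k, w ≤ g x (y k)) (hc : ∀ k, c ≤ μ (C k))
    (hl : ∀ k, ∀ x ∈ C k, ∀ z ∈ C (k + 1), l k ≤ p x z) (ν : Measure X) (m : ℕ) :
    initialMass Q g ν (C 1) (y 0) * (w * ((w * c) ^ m * ∏ i ∈ Finset.range m, l (1 + i))) ≤
      unnormalizedFilter Q g ν y (m + 1) Set.univ := by
  set D := w * ((w * c) ^ m * ∏ i ∈ Finset.range m, l (1 + i))
  have h1 := lintegral_unnormalizedFilter_zero (μ := μ) hp hQ hg
    (measurable_const (a := (1 : ℝ≥0∞))) ν (m + 1)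
  rw [lintegral_one] at h1
  have h2 : Measurable fun x => g x (y 0) * Q x (C 1) := (hg 0).mul (Q.measurable_coe (hC 1))
  rw [h1, initialMass, ← lintegral_mul_const _ h2]
  refine lintegral_mono fun x => ?_
  rw [mul_assoc]
  gcongr
  calc Q x (C 1) * D = ∫⁻ z in C 1, p x z * D ∂μ := by
        rw [hQ, withDensity_apply _ (hC 1), lintegral_mul_const _ hp.of_uncurry_left]
    _ ≤ ∫⁻ z in C 1, p x z *
          (g z (y 1) * backward μ p (fun k x => g x (y k)) 1 m (fun _ => 1) z) ∂μ := by
        refine setLIntegral_mono' (hC _) fun z hz => ?_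
        simp only [D]
        gcongr
        exacts [hG 1 z hz, le_backward_one hC hG hc hl 1 m z hz]
    _ ≤ _ := setLIntegral_le_lintegral _ _

/-! ### Coupling on the product space -/

/-- The backward operator on pairs, applied to the constant `1`, with extra weights `w`. -/
def pairBackward (μ : Measure X) (p : X → X → ℝ≥0∞) (G : ℕ → X → ℝ≥0∞)
    (w : ℕ → X × X → X × X → ℝ≥0∞) : ℕ → ℕ → X × X → ℝ≥0∞
  | _, 0 => fun _ => 1
  | k, m + 1 => fun x => ∫⁻ z, (p x.1 z.1 * p x.2 z.2) * ((G (k + 1) z.1 * G (k + 1) z.2) *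
      (w k x z * pairBackward μ p G w (k + 1) m z)) ∂(μ.prod μ)

variable {w : ℕ → X × X → X × X → ℝ≥0∞}

/-- One coupling step: if the product kernel dominates a part `c` that is symmetric in the arrival
pair, up to `w` times itself, then antisymmetric differences contract by `w`. -/
lemma coupling_step (hp : Measurable (Function.uncurry p)) {g U V : X → ℝ≥0∞} (hg : Measurable g)
    (hU : Measurable U) (hV : Measurable V) {W : X × X → ℝ≥0∞}
    {x : X × X} {w c : X × X → ℝ≥0∞} (hc : Measurable c)
    (hUV : ∀ z : X × X, U z.1 * V z.2 ≤ V z.1 * U z.2 + W z)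
    (hsymm : ∀ z, c z.swap = c z) (hcP : ∀ z, c z ≤ p x.1 z.1 * p x.2 z.2)
    (hcw : ∀ z, p x.1 z.1 * p x.2 z.2 - c z ≤ p x.1 z.1 * p x.2 z.2 * w z) :
    (∫⁻ z, p x.1 z * (g z * U z) ∂μ) * (∫⁻ z, p x.2 z * (g z * V z) ∂μ) ≤
      (∫⁻ z, p x.1 z * (g z * V z) ∂μ) * (∫⁻ z, p x.2 z * (g z * U z) ∂μ) +
      ∫⁻ z, (p x.1 z.1 * p x.2 z.2) * ((g z.1 * g z.2) * (w z * W z)) ∂(μ.prod μ) := by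
  have hpx : ∀ x, Measurable (p x) := fun x => hp.of_uncurry_left
  have hprod : ∀ {U V : X → ℝ≥0∞}, Measurable U → Measurable V →
      (∫⁻ z, p x.1 z * (g z * U z) ∂μ) * (∫⁻ z, p x.2 z * (g z * V z) ∂μ) =
      ∫⁻ z, (p x.1 z.1 * p x.2 z.2) * ((g z.1 * g z.2) * (U z.1 * V z.2)) ∂(μ.prod μ) := by
    intro U V hU hV
    have h1 : Measurable fun z => p x.1 z * (g z * U z) := (hpx _).mul (hg.mul hU)
    have h2 : Measurable fun z => p x.2 z * (g z * V z) := (hpx _).mul (hg.mul hV)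
    rw [← lintegral_prod_mul h1.aemeasurable h2.aemeasurable]
    exact lintegral_congr fun z => by ring
  rw [hprod hU hV, hprod hV hU]
  set P : X × X → ℝ≥0∞ := fun z => p x.1 z.1 * p x.2 z.2
  have hP : Measurable P := ((hpx _).comp measurable_fst).mul ((hpx _).comp measurable_snd)
  set gg : X × X → ℝ≥0∞ := fun z => g z.1 * g z.2
  have hgg : Measurable gg := (hg.comp measurable_fst).mul (hg.comp measurable_snd)
  have hVU : Measurable fun z : X × X => V z.1 * U z.2 :=
    (hV.comp measurable_fst).mul (hU.comp measurable_snd)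
  have hUV' : Measurable fun z : X × X => U z.1 * V z.2 :=
    (hU.comp measurable_fst).mul (hV.comp measurable_snd)
  have hcVU : Measurable fun z => c z * (gg z * (V z.1 * U z.2)) := hc.mul (hgg.mul hVU)
  have hcUV : Measurable fun z => c z * (gg z * (U z.1 * V z.2)) := hc.mul (hgg.mul hUV')
  have hsplit : ∀ z, P z = c z + (P z - c z) := fun z => (add_tsub_cancel_of_le (hcP z)).symm
  -- Exchanging the two arrival points leaves `c`, `gg` and `μ.prod μ` invariant and turns `U ⊗ V`
  -- into `V ⊗ U`: the common part contributes equally to both sides.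
  have hswap : ∫⁻ z, c z * (gg z * (U z.1 * V z.2)) ∂(μ.prod μ) =
      ∫⁻ z, c z * (gg z * (V z.1 * U z.2)) ∂(μ.prod μ) := by
    rw [← lintegral_prod_swap (fun z => c z * (gg z * (U z.1 * V z.2)))]
    refine lintegral_congr fun z => ?_
    rw [hsymm]
    simp only [gg, Prod.fst_swap, Prod.snd_swap]
    ring
  calc ∫⁻ z, P z * (gg z * (U z.1 * V z.2)) ∂(μ.prod μ)
      = ∫⁻ z, (c z * (gg z * (U z.1 * V z.2)) + (P z - c z) * (gg z * (U z.1 * V z.2)))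
          ∂(μ.prod μ) := lintegral_congr fun z => by rw [← add_mul, ← hsplit]
    _ = ∫⁻ z, c z * (gg z * (V z.1 * U z.2)) ∂(μ.prod μ) +
          ∫⁻ z, (P z - c z) * (gg z * (U z.1 * V z.2)) ∂(μ.prod μ) := by
        rw [lintegral_add_left hcUV, hswap]
    _ = ∫⁻ z, (c z * (gg z * (V z.1 * U z.2)) + (P z - c z) * (gg z * (U z.1 * V z.2)))
          ∂(μ.prod μ) := by rw [lintegral_add_left hcVU]
    _ ≤ ∫⁻ z, (P z * (gg z * (V z.1 * U z.2)) + P z * (gg z * (w z * W z))) ∂(μ.prod μ) := by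
        refine lintegral_mono fun z => ?_
        calc c z * (gg z * (V z.1 * U z.2)) + (P z - c z) * (gg z * (U z.1 * V z.2))
            ≤ c z * (gg z * (V z.1 * U z.2)) +
                (P z - c z) * (gg z * (V z.1 * U z.2 + W z)) := by gcongr; exact hUV z
          _ = (c z + (P z - c z)) * (gg z * (V z.1 * U z.2)) + (P z - c z) * (gg z * W z) := by
              ring
          _ ≤ P z * (gg z * (V z.1 * U z.2)) + P z * w z * (gg z * W z) := by
              rw [← hsplit]; gcongr; exact hcw z
          _ = _ := by ring
    _ = _ := lintegral_add_left (hP.mul (hgg.mul hVU)) _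

/-- Iterated coupling. -/
lemma backward_mul_le_add_pairBackward (hp : Measurable (Function.uncurry p))
    (hG : ∀ k, Measurable (G k)) {c : ℕ → X × X → X × X → ℝ≥0∞}
    (hc : ∀ k x, Measurable (c k x)) (hsymm : ∀ k x z, c k x z.swap = c k x z)
    (hcP : ∀ k x z, c k x z ≤ p x.1 z.1 * p x.2 z.2)
    (hcw : ∀ k x z, p x.1 z.1 * p x.2 z.2 - c k x z ≤ p x.1 z.1 * p x.2 z.2 * w k x z)
    {φ : X → ℝ≥0∞} (hφ : Measurable φ) (hφ1 : ∀ x, φ x ≤ 1) (k m : ℕ) (x : X × X) :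
    backward μ p G k m φ x.1 * backward μ p G k m (fun _ => 1) x.2 ≤
      backward μ p G k m (fun _ => 1) x.1 * backward μ p G k m φ x.2 +
        pairBackward μ p G w k m x := by
  induction m generalizing k x with
  | zero =>
    simp only [backward, pairBackward, mul_one, one_mul]
    exact (hφ1 _).trans le_add_self
  | succ m ih =>
    exact coupling_step hp (hG _) (measurable_backward hp hG hφ _ _)
      (measurable_backward hp hG measurable_const _ _) (hc k x) (fun z => ih (k + 1) z)
      (hsymm k x) (hcP k x) (hcw k x)

end Backward

/-! ### Counting coupled, inactive and bad transitions of pairs -/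

section Counting

variable {X : Type*}

/-- The weight equal to `1` on `C` and to `θ ^ 2` off `C`. -/
def exitWeight (θ : ℝ≥0∞) (C : Set X) (x : X) : ℝ≥0∞ :=
  open Classical in if x ∈ C then 1 else θ ^ 2

/-- The pairs of transitions from `C × C` to `C' × C'` along which the density is at most `M`. -/
def coupledPairs (p : X → X → ℝ≥0∞) (M : ℝ≥0∞) (C C' : Set X) : Set ((X × X) × (X × X)) :=
  {u | (u.1.1 ∈ C ∧ u.1.2 ∈ C) ∧ (u.2.1 ∈ C' ∧ u.2.2 ∈ C') ∧
    p u.1.1 u.2.1 ≤ M ∧ p u.1.2 u.2.2 ≤ M}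

/-- The contraction factor `ρ` at active times on `coupledPairs`, and `1` elsewhere. -/
def couplingWeight (p : X → X → ℝ≥0∞) (M ρ : ℝ≥0∞) (act : ℕ → Prop) (C : ℕ → Set X) (k : ℕ)
    (x z : X × X) : ℝ≥0∞ :=
  open Classical in if act k ∧ (x, z) ∈ coupledPairs p M (C k) (C (k + 1)) then ρ else 1

/-- The common symmetric part of the transition densities of pairs starting in `C × C`. -/
def commonPart (c₀ : ℝ≥0∞) (act : ℕ → Prop) (C : ℕ → Set X) (k : ℕ) (x z : X × X) : ℝ≥0∞ :=
  open Classical in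
  if act k ∧ (x.1 ∈ C k ∧ x.2 ∈ C k) ∧ (z.1 ∈ C (k + 1) ∧ z.2 ∈ C (k + 1)) then c₀ ^ 2 else 0

/-- The number of inactive times among `k, …, k + m - 1`. -/
def inactiveCount (act : ℕ → Prop) (k m : ℕ) : ℕ :=
  open Classical in ∑ i ∈ Finset.range m, if act (k + i) then 0 else 1

lemma inactiveCount_succ (act : ℕ → Prop) (k m : ℕ) :
    inactiveCount act k (m + 1) =
      inactiveCount act (k + 1) m + (open Classical in if act k then 0 else 1) := by
  classical
  rw [inactiveCount, Finset.sum_range_succ']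
  congr 1
  refine Finset.sum_congr rfl fun i _ => if_congr ?_ rfl rfl
  rw [add_assoc, add_comm 1]

lemma one_le_exitWeight {θ : ℝ≥0∞} (hθ : 1 ≤ θ) (C : Set X) (x : X) : 1 ≤ exitWeight θ C x := by
  unfold exitWeight
  split_ifs
  exacts [le_rfl, one_le_pow₀ hθ]

/-- The symmetry is the reason why `commonPart` ignores the truncation `p ≤ M`: that condition ties
each arrival point to its own starting point and does not survive the swap. -/
lemma commonPart_swap (c₀ : ℝ≥0∞) (act : ℕ → Prop) (C : ℕ → Set X) (k : ℕ) (x z : X × X) :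
    commonPart c₀ act C k x z.swap = commonPart c₀ act C k x z := by
  classical
  exact if_congr (and_congr_right fun _ => and_congr_right fun _ => and_comm) rfl rfl

lemma commonPart_le {p : X → X → ℝ≥0∞} {c₀ : ℝ≥0∞} {act : ℕ → Prop} {C : ℕ → Set X}
    (hact : ∀ k, act k → ∀ x ∈ C k, ∀ z ∈ C (k + 1), c₀ ≤ p x z) (k : ℕ) (x z : X × X) :
    commonPart c₀ act C k x z ≤ p x.1 z.1 * p x.2 z.2 := by
  unfold commonPart
  split_ifs with h
  · rw [pow_two]
    exact mul_le_mul' (hact k h.1 _ h.2.1.1 _ h.2.2.1) (hact k h.1 _ h.2.1.2 _ h.2.2.2)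
  · exact zero_le

/-- On `coupledPairs` the product density is at most `M ^ 2`, so removing `c₀ ^ 2` removes at least
the fraction `c₀ ^ 2 / M ^ 2` of it. -/
lemma sub_commonPart_le {p : X → X → ℝ≥0∞} {c₀ M ρ : ℝ≥0∞} {act : ℕ → Prop} {C : ℕ → Set X}
    (hM : M ≠ ⊤) (hM0 : M ≠ 0) (hρ : 1 ≤ ρ + c₀ ^ 2 / M ^ 2) (k : ℕ) (x z : X × X) :
    p x.1 z.1 * p x.2 z.2 - commonPart c₀ act C k x z ≤
      p x.1 z.1 * p x.2 z.2 * couplingWeight p M ρ act C k x z := by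
  unfold couplingWeight
  split_ifs with h
  · rw [commonPart, if_pos ⟨h.1, h.2.1, h.2.2.1⟩, tsub_le_iff_right]
    set P := p x.1 z.1 * p x.2 z.2
    have hP : P ≤ M ^ 2 := by
      rw [pow_two]
      exact mul_le_mul' h.2.2.2.1 h.2.2.2.2
    calc P ≤ P * (ρ + c₀ ^ 2 / M ^ 2) := le_mul_of_one_le_right' hρ
      _ = P * ρ + P * (c₀ ^ 2 / M ^ 2) := mul_add _ _ _
      _ ≤ P * ρ + M ^ 2 * (c₀ ^ 2 / M ^ 2) := by gcongr
      _ = P * ρ + c₀ ^ 2 := by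
        rw [ENNReal.mul_div_cancel (pow_ne_zero _ hM0) (ENNReal.pow_ne_top hM)]
  · rw [mul_one]
    exact tsub_le_self

/-- A transition of pairs outside `coupledPairs` has a coordinate with an exit weight `θ ^ 2`. -/
lemma sq_le_exitWeights {p : X → X → ℝ≥0∞} {M θ : ℝ≥0∞} (hθ : 1 ≤ θ) {C C' : Set X}
    {x z : X × X} (h : (x, z) ∉ coupledPairs p M C C') :
    θ ^ 2 ≤ (exitWeight θ C x.1 * exitWeight θ {z | p x.1 z ≤ M} z.1 * exitWeight θ C' z.1) *
      (exitWeight θ C x.2 * exitWeight θ {z | p x.2 z ≤ M} z.2 * exitWeight θ C' z.2) := by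
  have key : ∃ D ∈ [(C, x.1), ({z | p x.1 z ≤ M}, z.1), (C', z.1), (C, x.2),
      ({z | p x.2 z ≤ M}, z.2), (C', z.2)], D.2 ∉ D.1 := by
    by_contra! hcon
    simp only [List.mem_cons, List.not_mem_nil, or_false, forall_eq_or_imp, forall_eq,
      Set.mem_ofPred_eq] at hcon
    exact h ⟨⟨hcon.1, hcon.2.2.2.1⟩, ⟨hcon.2.2.1, hcon.2.2.2.2.2⟩, hcon.2.1, hcon.2.2.2.2.1⟩
  obtain ⟨D, hD, hDn⟩ := key
  have hval : θ ^ 2 ≤ exitWeight θ D.1 D.2 := by rw [exitWeight, if_neg hDn]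
  have h1 := fun (C : Set X) x => one_le_exitWeight hθ C x
  have hmul : ∀ {a b : ℝ≥0∞}, 1 ≤ a → 1 ≤ b → 1 ≤ a * b := fun ha hb => one_le_mul ha hb
  have hleft : ∀ {a b c : ℝ≥0∞}, a ≤ b → 1 ≤ c → a ≤ b * c := fun h h' =>
    h.trans (le_mul_of_one_le_right' h')
  have hright : ∀ {a b c : ℝ≥0∞}, 1 ≤ c → a ≤ b → a ≤ c * b := fun h' h =>
    h.trans (le_mul_of_one_le_left' h')
  simp only [List.mem_cons, List.not_mem_nil, or_false] at hD
  rcases hD with rfl | rfl | rfl | rfl | rfl | rfl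
  · exact hleft (hleft (hleft hval (h1 _ _))
      (h1 _ _)) (hmul (hmul (h1 _ _) (h1 _ _)) (h1 _ _))
  · exact hleft (hleft (hright (h1 _ _) hval)
      (h1 _ _)) (hmul (hmul (h1 _ _) (h1 _ _)) (h1 _ _))
  · exact hleft (hright (hmul (h1 _ _) (h1 _ _)) hval)
      (hmul (hmul (h1 _ _) (h1 _ _)) (h1 _ _))
  · exact hright (hmul (hmul (h1 _ _) (h1 _ _)) (h1 _ _))
      (hleft (hleft hval (h1 _ _)) (h1 _ _))
  · exact hright (hmul (hmul (h1 _ _) (h1 _ _)) (h1 _ _))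
      (hleft (hright (h1 _ _) hval) (h1 _ _))
  · exact hright (hmul (hmul (h1 _ _) (h1 _ _)) (h1 _ _))
      (hright (hmul (h1 _ _) (h1 _ _)) hval)

/-- If `n > 4 * G` and `n > 4 * S`, then `B` exceeds `n / 2`. So one of `n ≤ 4 * G`, `n ≤ 4 * S`, `n
≤ 2 * B` holds, and the corresponding term on the right dominates. This is where the exponents `4`,
`4`, `2` used below come from. -/
lemma pow_le_of_le_add {r t θ : ℝ≥0∞} (hr : r ≤ 1) (ht : 1 ≤ t) (ht' : t ≠ ⊤) (hθ : 1 ≤ θ)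
    (hθ' : θ ≠ ⊤) {n G B S : ℕ} (h : n ≤ G + B + S) :
    r ^ (4 * G) ≤ r ^ n + t ^ (4 * S) / t ^ n + θ ^ (2 * B) / θ ^ n := by
  have aux : ∀ {u : ℝ≥0∞}, 1 ≤ u → u ≠ ⊤ → ∀ {e : ℕ}, n ≤ e → 1 ≤ u ^ e / u ^ n := by
    intro u hu hu' e he
    rw [ENNReal.le_div_iff_mul_le (Or.inl (pow_ne_zero _ (one_pos.trans_le hu).ne'))
      (Or.inl (ENNReal.pow_ne_top hu')), one_mul]
    exact pow_le_pow_right₀ hu he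
  have h1 : r ^ (4 * G) ≤ 1 := pow_le_one' hr _
  rcases le_or_gt n (4 * G) with hG | hG
  · exact (pow_le_pow_right_of_le_one' hr hG).trans (le_self_add.trans le_self_add)
  rcases le_or_gt n (4 * S) with hS | hS
  · exact h1.trans ((aux ht ht' hS).trans (le_add_self.trans le_self_add))
  · exact h1.trans ((aux hθ hθ' (by omega)).trans le_add_self)

variable [MeasurableSpace X]

lemma measurable_exitWeight (θ : ℝ≥0∞) {C : Set X} (hC : MeasurableSet C) :
    Measurable (exitWeight θ C) :=
  Measurable.ite hC measurable_const measurable_const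

lemma measurable_commonPart (c₀ : ℝ≥0∞) (act : ℕ → Prop) {C : ℕ → Set X}
    (hC : ∀ k, MeasurableSet (C k)) (k : ℕ) (x : X × X) :
    Measurable (commonPart c₀ act C k x) :=
  Measurable.ite ((MeasurableSet.const _).inter ((MeasurableSet.const _).inter
    ((measurable_fst (hC _)).inter (measurable_snd (hC _))))) measurable_const measurable_const

variable {μ : Measure X} [SFinite μ] {p : X → X → ℝ≥0∞} {G : ℕ → X → ℝ≥0∞}

/-- Trajectories of pairs either meet `coupledPairs` often at active times, or there are many
inactive times, or the trajectory carries a large exit weight. -/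
lemma pow_mul_pairBackward_le (hp : Measurable (Function.uncurry p)) (hG : ∀ k, Measurable (G k))
    {C : ℕ → Set X} (hC : ∀ k, MeasurableSet (C k)) {act : ℕ → Prop} {M r t θ V : ℝ≥0∞}
    (hr : r ≤ 1) (ht : 1 ≤ t) (ht' : t ≠ ⊤) (hθ : 1 ≤ θ) (hθ' : θ ≠ ⊤)
    (hV : ∀ k x, G k x * exitWeight θ (C k) x ^ 2 ≤ V)
    (hM : ∀ x, ∫⁻ z, p x z * exitWeight θ {z | p x z ≤ M} z ∂μ ≤ 2) {n m k e B S : ℕ}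
    (hn : k + m = n) (hk : k ≤ e + B + S) (x : X × X) :
    r ^ (4 * e) * pairBackward μ p G (couplingWeight p M (r ^ 4) act C) k m x ≤
      (r ^ n + t ^ (4 * (S + inactiveCount act k m)) / t ^ n) *
        (backward μ p G k m (fun _ => 1) x.1 * backward μ p G k m (fun _ => 1) x.2) +
      θ ^ (2 * B) / θ ^ n *
        (exitWeight θ (C k) x.1 * exitWeight θ (C k) x.2 * (2 * V) ^ (2 * m)) := by
  induction m generalizing k e B S x with
  | zero =>
    obtain rfl : k = n := hn
    simp only [pairBackward, backward, mul_one, inactiveCount, Finset.range_zero, Finset.sum_empty,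
      add_zero, mul_zero, pow_zero]
    refine (pow_le_of_le_add hr ht ht' hθ hθ' hk).trans ?_
    gcongr
    exact le_mul_of_one_le_right' (one_le_mul (one_le_exitWeight hθ _ _) (one_le_exitWeight hθ _ _))
  | succ m ih =>
    set a := r ^ n + t ^ (4 * (S + inactiveCount act k (m + 1))) / t ^ n
    set b := θ ^ (2 * B) / θ ^ n
    set τ : X → ℝ≥0∞ := exitWeight θ (C (k + 1))
    set σ : X → X → ℝ≥0∞ := fun x => exitWeight θ {z | p x z ≤ M}
    set L := backward μ p G (k + 1) m fun _ => 1
    set W := pairBackward μ p G (couplingWeight p M (r ^ 4) act C) (k + 1) m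
    set w := couplingWeight p M (r ^ 4) act C k x
    have hpx : ∀ x, Measurable (p x) := fun x => hp.of_uncurry_left
    have hL : Measurable L := measurable_backward hp hG measurable_const _ _
    have hτ : Measurable τ := measurable_exitWeight θ (hC _)
    have hσ : ∀ x, Measurable (σ x) := fun x =>
      measurable_exitWeight θ (measurableSet_le (hpx x) measurable_const)
    set κ := exitWeight θ (C k) x.1 * exitWeight θ (C k) x.2
    have hκ : 1 ≤ κ := one_le_mul (one_le_exitWeight hθ _ _) (one_le_exitWeight hθ _ _)
    have hτ1 : ∀ z, 1 ≤ τ z := one_le_exitWeight hθ _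
    have hσ1 : ∀ x z, 1 ≤ σ x z := fun x => one_le_exitWeight hθ _
    have hE1 : ∀ z : X × X, 1 ≤ κ * ((σ x.1 z.1 * τ z.1) * (σ x.2 z.2 * τ z.2)) := fun z =>
      one_le_mul hκ (one_le_mul (one_le_mul (hσ1 _ _) (hτ1 _)) (one_le_mul (hσ1 _ _) (hτ1 _)))
    -- The induction hypothesis is applied with one counter raised: `e` for a coupled transition,
    -- paid by the factor `r ^ 4`; `B` for an active uncoupled one, paid by an exit weight; `S` for
    -- an inactive one, already recorded in `inactiveCount`.
    have hpt : ∀ z : X × X, r ^ (4 * e) * (w z * W z) ≤ a * (L z.1 * L z.2) +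
        b * κ * (2 * V) ^ (2 * m) * ((σ x.1 z.1 * τ z.1 ^ 2) * (σ x.2 z.2 * τ z.2 ^ 2)) := by
      intro z
      -- Each `τ ^ 2` is split: one factor pays for the transition arriving at `z`, the other is the
      -- prefactor in the induction hypothesis and pays for the transition leaving `z`. Hence the
      -- square in `hV`.
      have hrhs : b * κ * (2 * V) ^ (2 * m) * ((σ x.1 z.1 * τ z.1 ^ 2) * (σ x.2 z.2 * τ z.2 ^ 2)) =
        (b * (κ * ((σ x.1 z.1 * τ z.1) * (σ x.2 z.2 * τ z.2)))) *
          (τ z.1 * τ z.2 * (2 * V) ^ (2 * m)) := by ring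
      rw [hrhs]
      by_cases hact : act k
      · have hin : inactiveCount act k (m + 1) = inactiveCount act (k + 1) m := by
          rw [inactiveCount_succ, if_pos hact, add_zero]
        by_cases hpair : (x, z) ∈ coupledPairs p M (C k) (C (k + 1))
        · have hw : w z = r ^ 4 := if_pos ⟨hact, hpair⟩
          have := ih (k := k + 1) (e := e + 1) (B := B) (S := S) (by omega) (by omega) z
          rw [hw, ← mul_assoc, ← pow_add, show 4 * e + 4 = 4 * (e + 1) by ring]
          refine this.trans ?_
          simp only [a, hin]
          gcongr
          exact le_mul_of_one_le_right' (hE1 z)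
        · have hw : w z = 1 := if_neg fun h => hpair h.2
          have := ih (k := k + 1) (e := e) (B := B + 1) (S := S) (by omega) (by omega) z
          rw [hw, one_mul]
          refine this.trans ?_
          simp only [a, hin]
          gcongr
          rw [show 2 * (B + 1) = 2 * B + 2 by ring, pow_add, ENNReal.mul_div_right_comm]
          gcongr
          refine (sq_le_exitWeights hθ hpair).trans (le_of_eq ?_)
          simp only [κ, σ, τ]
          ring
      · have hw : w z = 1 := if_neg fun h => hact h.1
        have := ih (k := k + 1) (e := e) (B := B) (S := S + 1) (by omega) (by omega) z
        rw [hw, one_mul]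
        refine this.trans ?_
        have hin : S + inactiveCount act k (m + 1) = S + 1 + inactiveCount act (k + 1) m := by
          rw [inactiveCount_succ, if_neg hact]; ring
        simp only [a, hin]
        gcongr
        exact le_mul_of_one_le_right' (hE1 z)
    set f : X → X → ℝ≥0∞ := fun y z => p y z * (G (k + 1) z * L z)
    set h : X → X → ℝ≥0∞ := fun y z => p y z * (G (k + 1) z * (σ y z * τ z ^ 2))
    have hf : ∀ y, Measurable (f y) := fun y => (hpx y).mul ((hG _).mul hL)
    have hh : ∀ y, Measurable (h y) := fun y =>
      (hpx y).mul ((hG _).mul ((hσ y).mul (hτ.pow_const 2)))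
    have hhV : ∀ y, ∫⁻ z, h y z ∂μ ≤ 2 * V := fun y => by
      calc ∫⁻ z, h y z ∂μ ≤ ∫⁻ z, (p y z * σ y z) * V ∂μ := by
            refine lintegral_mono fun z => ?_
            calc h y z = (p y z * σ y z) * (G (k + 1) z * τ z ^ 2) := by simp only [h]; ring
              _ ≤ _ := by gcongr; exact hV _ _
        _ = (∫⁻ z, p y z * σ y z ∂μ) * V := lintegral_mul_const _ ((hpx y).mul (hσ y))
        _ ≤ 2 * V := by gcongr; exact hM y
    have hff : Measurable fun z : X × X => f x.1 z.1 * f x.2 z.2 :=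
      ((hf _).comp measurable_fst).mul ((hf _).comp measurable_snd)
    have hhh : Measurable fun z : X × X => h x.1 z.1 * h x.2 z.2 :=
      ((hh _).comp measurable_fst).mul ((hh _).comp measurable_snd)
    calc r ^ (4 * e) * pairBackward μ p G (couplingWeight p M (r ^ 4) act C) k (m + 1) x
        ≤ ∫⁻ z, r ^ (4 * e) * ((p x.1 z.1 * p x.2 z.2) *
            ((G (k + 1) z.1 * G (k + 1) z.2) * (w z * W z))) ∂(μ.prod μ) :=
          lintegral_const_mul_le _ _
      _ ≤ ∫⁻ z, (a * (f x.1 z.1 * f x.2 z.2) +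
            b * κ * (2 * V) ^ (2 * m) * (h x.1 z.1 * h x.2 z.2)) ∂(μ.prod μ) := by
          refine lintegral_mono fun z => ?_
          calc r ^ (4 * e) * ((p x.1 z.1 * p x.2 z.2) *
              ((G (k + 1) z.1 * G (k + 1) z.2) * (w z * W z)))
              = (p x.1 z.1 * p x.2 z.2) * ((G (k + 1) z.1 * G (k + 1) z.2) *
                (r ^ (4 * e) * (w z * W z))) := by ring
            _ ≤ (p x.1 z.1 * p x.2 z.2) * ((G (k + 1) z.1 * G (k + 1) z.2) *
                (a * (L z.1 * L z.2) + b * κ * (2 * V) ^ (2 * m) *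
                  ((σ x.1 z.1 * τ z.1 ^ 2) * (σ x.2 z.2 * τ z.2 ^ 2)))) := by gcongr; exact hpt z
            _ = _ := by simp only [f, h]; ring
      _ = a * ((∫⁻ z, f x.1 z ∂μ) * ∫⁻ z, f x.2 z ∂μ) + b * κ * (2 * V) ^ (2 * m) *
            ((∫⁻ z, h x.1 z ∂μ) * ∫⁻ z, h x.2 z ∂μ) := by
          rw [lintegral_add_left (hff.const_mul a), lintegral_const_mul _ hff,
            lintegral_const_mul _ hhh, lintegral_prod_mul (hf _).aemeasurable (hf _).aemeasurable,
            lintegral_prod_mul (hh _).aemeasurable (hh _).aemeasurable]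
      _ ≤ a * ((∫⁻ z, f x.1 z ∂μ) * ∫⁻ z, f x.2 z ∂μ) + b * κ * (2 * V) ^ (2 * m) *
            ((2 * V) * (2 * V)) := by gcongr <;> exact hhV _
      _ = a * ((∫⁻ z, f x.1 z ∂μ) * ∫⁻ z, f x.2 z ∂μ) +
            b * (κ * (2 * V) ^ (2 * (m + 1))) := by ring

end Counting

/-! ### From cross products of masses to total variation -/

section TotalVariation

variable {X : Type*} [MeasurableSpace X]

lemma ofReal_abs_toReal_sub_le {α β e : ℝ≥0∞} (hα : α ≠ ⊤) (hβ : β ≠ ⊤) (h₁ : α ≤ β + e)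
    (h₂ : β ≤ α + e) : ENNReal.ofReal |α.toReal - β.toReal| ≤ e := by
  rcases eq_or_ne e ⊤ with rfl | he
  · exact le_top
  rw [ENNReal.ofReal_le_iff_le_toReal he, abs_sub_le_iff, sub_le_iff_le_add', sub_le_iff_le_add',
    ← ENNReal.toReal_add hβ he, ← ENNReal.toReal_add hα he]
  exact ⟨ENNReal.toReal_mono (by finiteness) h₁, ENNReal.toReal_mono (by finiteness) h₂⟩

/-- No condition on the total mass is needed: masses `0` and `⊤` both normalize to the zero measure.
-/
lemma normalized_apply_le_one (μ : Measure X) (A : Set X) :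
    ((μ Set.univ)⁻¹ • μ) A ≤ 1 := by
  refine (measure_mono (Set.subset_univ A)).trans ?_
  rw [Measure.smul_apply, smul_eq_mul, mul_comm]
  exact ENNReal.mul_inv_le_one _

lemma tvDist_normalized_le_one (μ₁ μ₂ : Measure X) :
    tvDist ((μ₁ Set.univ)⁻¹ • μ₁) ((μ₂ Set.univ)⁻¹ • μ₂) ≤ 1 := by
  refine iSup₂_le fun A _ => ?_
  have h₁ := normalized_apply_le_one μ₁ A
  have h₂ := normalized_apply_le_one μ₂ A
  exact ofReal_abs_toReal_sub_le (h₁.trans_lt ENNReal.one_lt_top).ne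
    (h₂.trans_lt ENNReal.one_lt_top).ne (h₁.trans le_add_self) (h₂.trans le_add_self)

lemma tvDist_normalized_le {μ₁ μ₂ : Measure X} (h₁ : μ₁ Set.univ ≠ 0) (h₁' : μ₁ Set.univ ≠ ⊤)
    (h₂ : μ₂ Set.univ ≠ 0) (h₂' : μ₂ Set.univ ≠ ⊤) {e : ℝ≥0∞}
    (h₁₂ : ∀ A, MeasurableSet A → μ₁ A * μ₂ Set.univ ≤
      μ₁ Set.univ * μ₂ A + e * (μ₁ Set.univ * μ₂ Set.univ))
    (h₂₁ : ∀ A, MeasurableSet A → μ₂ A * μ₁ Set.univ ≤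
      μ₂ Set.univ * μ₁ A + e * (μ₂ Set.univ * μ₁ Set.univ)) :
    tvDist ((μ₁ Set.univ)⁻¹ • μ₁) ((μ₂ Set.univ)⁻¹ • μ₂) ≤ e := by
  have key : ∀ {a b m₁ m₂ : ℝ≥0∞}, m₁ ≠ 0 → m₁ ≠ ⊤ → m₂ ≠ 0 → m₂ ≠ ⊤ →
      a * m₂ ≤ m₁ * b + e * (m₁ * m₂) → m₁⁻¹ * a ≤ m₂⁻¹ * b + e := by
    intro a b m₁ m₂ h1 h1' h2 h2' h
    calc m₁⁻¹ * a = m₁⁻¹ * m₂⁻¹ * (a * m₂) := by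
          rw [show m₁⁻¹ * m₂⁻¹ * (a * m₂) = m₁⁻¹ * a * (m₂⁻¹ * m₂) by ring,
            ENNReal.inv_mul_cancel h2 h2', mul_one]
      _ ≤ m₁⁻¹ * m₂⁻¹ * (m₁ * b + e * (m₁ * m₂)) := by gcongr
      _ = (m₁⁻¹ * m₁) * (m₂⁻¹ * b) + e * ((m₁⁻¹ * m₁) * (m₂⁻¹ * m₂)) := by ring
      _ = m₂⁻¹ * b + e := by
          rw [ENNReal.inv_mul_cancel h1 h1', ENNReal.inv_mul_cancel h2 h2', one_mul, one_mul,
            mul_one]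
  refine iSup₂_le fun A hA => ?_
  exact ofReal_abs_toReal_sub_le
    ((normalized_apply_le_one μ₁ A).trans_lt ENNReal.one_lt_top).ne
    ((normalized_apply_le_one μ₂ A).trans_lt ENNReal.one_lt_top).ne
    (key h₁ h₁' h₂ h₂' (h₁₂ A hA)) (key h₂ h₂' h₁ h₁' (h₂₁ A hA))

variable {Y : Type*} {μ : Measure X} [SFinite μ] {p : X → X → ℝ≥0∞} {Q : Kernel X X}
  {g : X → Y → ℝ≥0∞} {y : ℕ → Y}

lemma unnormalizedFilter_univ_le (hp : Measurable (Function.uncurry p))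
    (hQ : ∀ x, Q x = μ.withDensity (p x)) (hg : ∀ k, Measurable fun x => g x (y k)) {V : ℝ≥0∞}
    (hV : ∀ k x, g x (y k) ≤ V) (hp1 : ∀ x, ∫⁻ z, p x z ∂μ ≤ 1) (ν : Measure X)
    [IsProbabilityMeasure ν] (n : ℕ) :
    unnormalizedFilter Q g ν y n Set.univ ≤ V * V ^ n := by
  have h := lintegral_unnormalizedFilter_zero (μ := μ) hp hQ hg
    (measurable_const (a := (1 : ℝ≥0∞))) ν n
  rw [lintegral_one] at h
  rw [h]
  calc _ ≤ ∫⁻ _, V * V ^ n ∂ν := lintegral_mono fun x => mul_le_mul' (hV 0 x)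
        (backward_le hV hp1 (fun _ => le_rfl) hp 0 n x)
    _ = V * V ^ n := by simp

/-- Comparison of two unnormalized filters. -/
lemma unnormalizedFilter_mul_le (hp : Measurable (Function.uncurry p))
    (hQ : ∀ x, Q x = μ.withDensity (p x)) (hg : ∀ k, Measurable fun x => g x (y k))
    {C : ℕ → Set X} (hC : ∀ k, MeasurableSet (C k)) {act : ℕ → Prop} {c₀ M r t θ V : ℝ≥0∞}
    (hr : r ≤ 1) (ht : 1 ≤ t) (ht' : t ≠ ⊤) (hθ : 1 ≤ θ) (hθ' : θ ≠ ⊤)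
    (hV : ∀ k x, g x (y k) * exitWeight θ (C k) x ^ 2 ≤ V)
    (hM : ∀ x, ∫⁻ z, p x z * exitWeight θ {z | p x z ≤ M} z ∂μ ≤ 2)
    (hM' : M ≠ ⊤) (hM0 : M ≠ 0) (hρ : 1 ≤ r ^ 4 + c₀ ^ 2 / M ^ 2)
    (hact : ∀ k, act k → ∀ x ∈ C k, ∀ z ∈ C (k + 1), c₀ ≤ p x z)
    (ν ν' : Measure X) [IsProbabilityMeasure ν] [IsProbabilityMeasure ν'] (n : ℕ)
    {A : Set X} (hA : MeasurableSet A) :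
    unnormalizedFilter Q g ν y n A * unnormalizedFilter Q g ν' y n Set.univ ≤
      unnormalizedFilter Q g ν y n Set.univ * unnormalizedFilter Q g ν' y n A +
      ((r ^ n + t ^ (4 * inactiveCount act 0 n) / t ^ n) *
        (unnormalizedFilter Q g ν y n Set.univ * unnormalizedFilter Q g ν' y n Set.univ) +
        V ^ 2 * (2 * V) ^ (2 * n) / θ ^ n) := by
  set G : ℕ → X → ℝ≥0∞ := fun k x => g x (y k)
  set φ : X → ℝ≥0∞ := A.indicator 1
  have hφ : Measurable φ := measurable_one.indicator hA
  have hφ1 : ∀ x, φ x ≤ 1 := Set.indicator_le_self' fun _ _ => zero_le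
  set U : X → ℝ≥0∞ := fun x => G 0 x * backward μ p G 0 n φ x
  set L : X → ℝ≥0∞ := fun x => G 0 x * backward μ p G 0 n (fun _ => 1) x
  have hU : Measurable U := (hg 0).mul (measurable_backward hp hg hφ 0 n)
  have hL : Measurable L := (hg 0).mul (measurable_backward hp hg measurable_const 0 n)
  have hγA : ∀ ν : Measure X, unnormalizedFilter Q g ν y n A = ∫⁻ x, U x ∂ν := fun ν => by
    rw [← lintegral_unnormalizedFilter_zero hp hQ hg hφ ν n, lintegral_indicator_one hA]
  have hγ : ∀ ν : Measure X, unnormalizedFilter Q g ν y n Set.univ = ∫⁻ x, L x ∂ν := fun ν => by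
    rw [← lintegral_unnormalizedFilter_zero hp hQ hg measurable_const ν n, lintegral_one]
  rw [hγA, hγA, hγ, hγ]
  set a := r ^ n + t ^ (4 * inactiveCount act 0 n) / t ^ n
  set R := V ^ 2 * (2 * V) ^ (2 * n) / θ ^ n
  set τ := exitWeight θ (C 0)
  -- No transition arrives at time `0`, so a single exit factor occurs there and the square in `hV`
  -- is more than enough.
  have hGτ : ∀ x, G 0 x * τ x ≤ V := fun x => by
    refine le_trans ?_ (hV 0 x)
    gcongr
    exact le_self_pow₀ (one_le_exitWeight hθ _ _) two_ne_zero
  have hpt : ∀ x : X × X, U x.1 * L x.2 ≤ L x.1 * U x.2 + (a * (L x.1 * L x.2) + R) := by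
    intro x
    have h1 := backward_mul_le_add_pairBackward (μ := μ) (G := G) hp hg
      (measurable_commonPart c₀ act hC) (commonPart_swap c₀ act C) (commonPart_le hact)
      (sub_commonPart_le hM' hM0 hρ) hφ hφ1 0 n x
    have h2 := pow_mul_pairBackward_le (μ := μ) (G := G) (act := act) hp hg hC hr ht ht' hθ hθ' hV hM
      (k := 0) (e := 0) (B := 0) (S := 0) (zero_add n) le_rfl x
    simp only [mul_zero, pow_zero, one_mul, zero_add] at h2
    calc U x.1 * L x.2 = (G 0 x.1 * G 0 x.2) *
          (backward μ p G 0 n φ x.1 * backward μ p G 0 n (fun _ => 1) x.2) := by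
          simp only [U, L]; ring
      _ ≤ (G 0 x.1 * G 0 x.2) * (backward μ p G 0 n (fun _ => 1) x.1 * backward μ p G 0 n φ x.2 +
          (a * (backward μ p G 0 n (fun _ => 1) x.1 * backward μ p G 0 n (fun _ => 1) x.2) +
            1 / θ ^ n * (τ x.1 * τ x.2 * (2 * V) ^ (2 * n)))) := by
          gcongr
          exact h1.trans (by gcongr)
      _ = L x.1 * U x.2 + (a * (L x.1 * L x.2) +
            ((G 0 x.1 * τ x.1) * (G 0 x.2 * τ x.2)) * (2 * V) ^ (2 * n) * (1 / θ ^ n)) := by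
          simp only [U, L]; ring
      _ ≤ L x.1 * U x.2 + (a * (L x.1 * L x.2) + (V * V) * (2 * V) ^ (2 * n) * (1 / θ ^ n)) := by
          gcongr <;> exact hGτ _
      _ = _ := by rw [mul_one_div, ← pow_two]
  have hLU : Measurable fun x : X × X => L x.1 * U x.2 :=
    (hL.comp measurable_fst).mul (hU.comp measurable_snd)
  have hLL : Measurable fun x : X × X => L x.1 * L x.2 :=
    (hL.comp measurable_fst).mul (hL.comp measurable_snd)
  calc (∫⁻ x, U x ∂ν) * ∫⁻ x, L x ∂ν' = ∫⁻ x, U x.1 * L x.2 ∂(ν.prod ν') :=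
        (lintegral_prod_mul hU.aemeasurable hL.aemeasurable).symm
    _ ≤ ∫⁻ x, (L x.1 * U x.2 + (a * (L x.1 * L x.2) + R)) ∂(ν.prod ν') := lintegral_mono hpt
    _ = _ := by
        rw [lintegral_add_left hLU, lintegral_add_left (hLL.const_mul a),
          lintegral_const_mul _ hLL, lintegral_prod_mul hL.aemeasurable hU.aemeasurable,
          lintegral_prod_mul hL.aemeasurable hL.aemeasurable]
        simp

/-- The first two error terms of `unnormalizedFilter_mul_le` carry the product of the masses and
survive normalization unchanged; only the exit term needs the lower bounds `b` and `b'`. The cap at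
`1` later allows a fractional power of that term. -/
theorem tvDist_filterMeasure_le (hp : Measurable (Function.uncurry p))
    (hp1 : ∀ x, ∫⁻ z, p x z ∂μ ≤ 1)
    (hQ : ∀ x, Q x = μ.withDensity (p x)) (hg : ∀ k, Measurable fun x => g x (y k))
    {C : ℕ → Set X} (hC : ∀ k, MeasurableSet (C k)) {act : ℕ → Prop} {c₀ M r t θ V : ℝ≥0∞}
    (hr : r ≤ 1) (ht : 1 ≤ t) (ht' : t ≠ ⊤) (hθ : 1 ≤ θ) (hθ' : θ ≠ ⊤) (hV0 : V ≠ 0)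
    (hV' : V ≠ ⊤)
    (hV : ∀ k x, g x (y k) * exitWeight θ (C k) x ^ 2 ≤ V)
    (hM : ∀ x, ∫⁻ z, p x z * exitWeight θ {z | p x z ≤ M} z ∂μ ≤ 2)
    (hM' : M ≠ ⊤) (hM0 : M ≠ 0) (hρ : 1 ≤ r ^ 4 + c₀ ^ 2 / M ^ 2)
    (hact : ∀ k, act k → ∀ x ∈ C k, ∀ z ∈ C (k + 1), c₀ ≤ p x z)
    (ν ν' : Measure X) [IsProbabilityMeasure ν] [IsProbabilityMeasure ν'] (n : ℕ)
    {b b' : ℝ≥0∞} (hb : b ≤ unnormalizedFilter Q g ν y n Set.univ)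
    (hb' : b' ≤ unnormalizedFilter Q g ν' y n Set.univ) :
    tvDist (filterMeasure Q g ν n y) (filterMeasure Q g ν' n y) ≤
      r ^ n + t ^ (4 * inactiveCount act 0 n) / t ^ n +
        min 1 (V ^ 2 * (2 * V) ^ (2 * n) / θ ^ n / (b * b')) := by
  set R := V ^ 2 * (2 * V) ^ (2 * n) / θ ^ n
  have hR0 : R ≠ 0 := ENNReal.div_ne_zero.2
    ⟨mul_ne_zero (pow_ne_zero _ hV0) (pow_ne_zero _ (mul_ne_zero two_ne_zero hV0)),
      ENNReal.pow_ne_top hθ'⟩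
  have hone : tvDist (filterMeasure Q g ν n y) (filterMeasure Q g ν' n y) ≤ 1 :=
    tvDist_normalized_le_one _ _
  rw [← min_add_add_left]
  refine le_min (hone.trans le_add_self) ?_
  -- With a vanishing lower bound the quotient is `⊤`, because its numerator is nonzero; the bound
  -- by `1` then suffices.
  rcases eq_or_ne (b * b') 0 with h0 | h0
  · rw [h0, ENNReal.div_zero hR0]
    simp
  have hgV : ∀ k x, g x (y k) ≤ V := fun k x =>
    (le_mul_of_one_le_right' (one_le_pow₀ (one_le_exitWeight hθ _ _))).trans (hV k x)
  have hfin : ∀ (ν : Measure X) [IsProbabilityMeasure ν],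
      unnormalizedFilter Q g ν y n Set.univ ≠ ⊤ := fun ν _ =>
    ((unnormalizedFilter_univ_le hp hQ hg hgV hp1 ν n).trans_lt (by finiteness)).ne
  have hbpos := mul_ne_zero_iff.1 h0
  have hγ0 : unnormalizedFilter Q g ν y n Set.univ ≠ 0 :=
    ((pos_iff_ne_zero.2 hbpos.1).trans_le hb).ne'
  have hγ0' : unnormalizedFilter Q g ν' y n Set.univ ≠ 0 :=
    ((pos_iff_ne_zero.2 hbpos.2).trans_le hb').ne'
  have hbt : b * b' ≠ ⊤ := ENNReal.mul_ne_top (hb.trans_lt (hfin ν).lt_top).ne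
    (hb'.trans_lt (hfin ν').lt_top).ne
  have hRle : ∀ {m : ℝ≥0∞}, b * b' ≤ m → R ≤ R / (b * b') * m := fun h => by
    calc R = R / (b * b') * (b * b') := (ENNReal.div_mul_cancel h0 hbt).symm
      _ ≤ _ := by gcongr
  refine tvDist_normalized_le hγ0 (hfin ν) hγ0' (hfin ν') (fun A hA => ?_) (fun A hA => ?_)
  · refine (unnormalizedFilter_mul_le (act := act) hp hQ hg hC hr ht ht' hθ hθ' hV hM hM' hM0 hρ hact ν ν' n
      hA).trans ?_
    rw [add_mul (r ^ n + _)]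
    gcongr
    exact hRle (mul_le_mul' hb hb')
  · refine (unnormalizedFilter_mul_le (act := act) hp hQ hg hC hr ht ht' hθ hθ' hV hM hM' hM0 hρ hact ν' ν n
      hA).trans ?_
    rw [add_mul (r ^ n + _)]
    gcongr
    exact hRle (by rw [mul_comm b]; exact mul_le_mul' hb' hb)

end TotalVariation

/-! ### Exponential moments along one-dependent noises -/

lemma mul_le_sq_add_sq (a b : ℝ≥0∞) : a * b ≤ a ^ 2 + b ^ 2 := by
  rcases le_total a b with h | h
  · exact (mul_le_mul_left h b).trans ((pow_two b).ge.trans le_add_self)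
  · exact (mul_le_mul_right h a).trans ((pow_two a).ge.trans le_self_add)

section Blocks

variable {Ω E F : Type*} [MeasurableSpace Ω] [MeasurableSpace E] [MeasurableSpace F]
  {P : Measure Ω} [IsProbabilityMeasure P] {ε : ℕ → Ω → E} {A : ℕ → Ω → F}

/-- Functions of disjoint consecutive pairs of an i.i.d. sequence are uncorrelated. -/
lemma lintegral_prod_consecutive_pairs (hε : ∀ k, Measurable (ε k)) (hind : iIndepFun ε P)
    {L : Measure E} (hlaw : ∀ k, P.map (ε k) = L)
    {h : ℕ → E × E → ℝ≥0∞} (hh : ∀ j, Measurable (h j)) (m : ℕ) :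
    ∫⁻ ω, ∏ j ∈ Finset.range m, h j (ε (2 * j) ω, ε (2 * j + 1) ω) ∂P =
      ∏ j ∈ Finset.range m, ∫⁻ u, h j u ∂(L.prod L) := by
  induction m with
  | zero => simp
  | succ m ih =>
    have hpair : P.map (fun ω => (ε (2 * m) ω, ε (2 * m + 1) ω)) = L.prod L := by
      rw [(indepFun_iff_map_prod_eq_prod_map_map (hε _).aemeasurable (hε _).aemeasurable).1
        (hind.indepFun (by omega)), hlaw, hlaw]
    have hdisj : Disjoint (Finset.range (2 * m)) ({2 * m, 2 * m + 1} : Finset ℕ) := by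
      rw [Finset.disjoint_left]
      intro k hk hk'
      simp only [Finset.mem_range, Finset.mem_insert, Finset.mem_singleton] at hk hk'
      omega
    have hI := hind.indepFun_finset _ _ hdisj hε
    let φ : (Finset.range (2 * m) → E) → ℝ≥0∞ := fun e => ∏ j : Fin m,
      h j (e ⟨2 * j, Finset.mem_range.2 (by omega)⟩, e ⟨2 * j + 1, Finset.mem_range.2 (by omega)⟩)
    let ψ : (({2 * m, 2 * m + 1} : Finset ℕ) → E) → ℝ≥0∞ := fun e =>
      h m (e ⟨2 * m, by simp⟩, e ⟨2 * m + 1, by simp⟩)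
    have hφ : Measurable φ := Finset.measurable_prod _ fun j _ =>
      (hh j).comp ((measurable_pi_apply _).prodMk (measurable_pi_apply _))
    have hψ : Measurable ψ := (hh m).comp ((measurable_pi_apply _).prodMk (measurable_pi_apply _))
    have hmul := lintegral_mul_eq_lintegral_mul_lintegral_of_indepFun
      (hφ.comp (measurable_pi_lambda _ fun i => hε i))
      (hψ.comp (measurable_pi_lambda _ fun i => hε i)) (hI.comp hφ hψ)
    have hφ' : ∀ ω, φ (fun i => ε i ω) =
        ∏ j ∈ Finset.range m, h j (ε (2 * j) ω, ε (2 * j + 1) ω) := fun ω =>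
      (Finset.prod_range fun j => h j (ε (2 * j) ω, ε (2 * j + 1) ω)).symm
    simp only [Finset.prod_range_succ, ← ih]
    have h2 : ∫⁻ u, h m u ∂(L.prod L) = ∫⁻ ω, h m (ε (2 * m) ω, ε (2 * m + 1) ω) ∂P := by
      rw [← hpair, lintegral_map (hh m) ((hε _).prodMk (hε _))]
    rw [h2]
    simp only [← hφ']
    exact hmul

/-- The common expectation `E Φ(ε_k, ε_{k+1}, A_{k+1})` when the `ε` have law `L`, the `A` have
law `L'` and everything is independent. -/
def blockMean (L : Measure E) (L' : Measure F) (Φ : (E × E) × F → ℝ≥0∞) : ℝ≥0∞ :=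
  ∫⁻ a, ∫⁻ u, Φ (u, a) ∂(L.prod L) ∂L'

/-- The sequence `A` is frozen and `ε` integrated first, over disjoint consecutive pairs; the result
is a product of functions of distinct `A`'s, hence of independent variables. The shift `i` serves
both even and odd blocks. -/
lemma lintegral_prod_blocks (hε : ∀ k, Measurable (ε k)) (hind : iIndepFun ε P)
    {L : Measure E} (hlaw : ∀ k, P.map (ε k) = L) (hA : ∀ k, Measurable (A k))
    (hAind : iIndepFun A P) {L' : Measure F} (hAlaw : ∀ k, P.map (A k) = L')
    (hAε : IndepFun (fun ω k => A k ω) (fun ω k => ε k ω) P)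
    {Φ : (E × E) × F → ℝ≥0∞} (hΦ : Measurable Φ) (i m : ℕ) :
    ∫⁻ ω, ∏ j ∈ Finset.range m, Φ ((ε (2 * j + i) ω, ε (2 * j + 1 + i) ω), A (2 * j + 1 + i) ω) ∂P =
      blockMean L L' Φ ^ m := by
  have hL : IsProbabilityMeasure L := hlaw 0 ▸ Measure.isProbabilityMeasure_map (hε 0).aemeasurable
  have hAm : Measurable fun ω k => A k ω := measurable_pi_lambda _ hA
  have hεm : Measurable fun ω k => ε k ω := measurable_pi_lambda _ hε
  have hprod := (indepFun_iff_map_prod_eq_prod_map_map hAm.aemeasurable hεm.aemeasurable).1 hAε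
  let Ψ : (ℕ → F) × (ℕ → E) → ℝ≥0∞ := fun w =>
    ∏ j ∈ Finset.range m, Φ ((w.2 (2 * j + i), w.2 (2 * j + 1 + i)), w.1 (2 * j + 1 + i))
  have hΨ : Measurable Ψ := Finset.measurable_prod _ fun j _ => hΦ.comp
    ((((measurable_pi_apply _).comp measurable_snd).prodMk
      ((measurable_pi_apply _).comp measurable_snd)).prodMk
      ((measurable_pi_apply _).comp measurable_fst))
  have hH : Measurable fun a => ∫⁻ u, Φ (u, a) ∂(L.prod L) := hΦ.lintegral_prod_left'
  have hinner : ∀ a : ℕ → F, ∫⁻ e, Ψ (a, e) ∂(P.map fun ω k => ε k ω) =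
      ∏ j ∈ Finset.range m, ∫⁻ u, Φ (u, a (2 * j + 1 + i)) ∂(L.prod L) := fun a => by
    have h1 : Measurable fun e => Ψ (a, e) := hΨ.comp measurable_prodMk_left
    rw [lintegral_map h1 hεm]
    exact lintegral_prod_consecutive_pairs (ε := fun k => ε (k + i)) (fun k => hε _)
      (hind.precomp (add_left_injective i)) (fun k => hlaw _)
      (h := fun j u => Φ (u, a (2 * j + 1 + i))) (fun j => hΦ.comp measurable_prodMk_right) m
  have hinj : Function.Injective fun j => 2 * j + 1 + i := fun j k (h : 2 * j + 1 + i = _) => by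
    simp only at h
    omega
  calc ∫⁻ ω, Ψ (fun k => A k ω, fun k => ε k ω) ∂P
      = ∫⁻ w, Ψ w ∂(P.map fun ω => (fun k => A k ω, fun k => ε k ω)) :=
        (lintegral_map hΨ (hAm.prodMk hεm)).symm
    _ = ∫⁻ a, ∫⁻ e, Ψ (a, e) ∂(P.map fun ω k => ε k ω) ∂(P.map fun ω k => A k ω) := by
        rw [hprod, lintegral_prod _ hΨ.aemeasurable]
    _ = ∫⁻ ω, ∏ j ∈ Finset.range m, ∫⁻ u, Φ (u, A (2 * j + 1 + i) ω) ∂(L.prod L) ∂P := by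
        simp only [hinner]
        have h1 : Measurable fun a : ℕ → F =>
            ∏ j ∈ Finset.range m, ∫⁻ u, Φ (u, a (2 * j + 1 + i)) ∂(L.prod L) :=
          Finset.measurable_prod _ fun j _ => hH.comp (measurable_pi_apply _)
        rw [lintegral_map h1 hAm]
    _ = ∏ j ∈ Finset.range m, ∫⁻ ω, ∫⁻ u, Φ (u, A (2 * j + 1 + i) ω) ∂(L.prod L) ∂P :=
        lintegral_prod_eq_prod_lintegral_of_indepFun _ _
          ((hAind.precomp hinj).comp _ fun _ => hH) fun j => hH.comp (hA _)
    _ = blockMean L L' Φ ^ m := by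
        rw [Finset.prod_congr rfl fun j _ => ?_, Finset.prod_const, Finset.card_range]
        rw [blockMean, ← hAlaw (2 * j + 1 + i), lintegral_map hH (hA _)]

lemma lintegral_block (hε : ∀ k, Measurable (ε k)) (hind : iIndepFun ε P)
    {L : Measure E} (hlaw : ∀ k, P.map (ε k) = L) (hA : ∀ k, Measurable (A k))
    (hAind : iIndepFun A P) {L' : Measure F} (hAlaw : ∀ k, P.map (A k) = L')
    (hAε : IndepFun (fun ω k => A k ω) (fun ω k => ε k ω) P)
    {Φ : (E × E) × F → ℝ≥0∞} (hΦ : Measurable Φ) :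
    ∫⁻ ω, Φ ((ε 0 ω, ε 1 ω), A 1 ω) ∂P = blockMean L L' Φ := by
  simpa using lintegral_prod_blocks hε hind hlaw hA hAind hAlaw hAε hΦ 0 1

/-- Exponential bound for multiplicative functionals of a `1`-dependent sequence. -/
lemma lintegral_prod_one_dependent_le (hε : ∀ k, Measurable (ε k)) (hind : iIndepFun ε P)
    {L : Measure E} (hlaw : ∀ k, P.map (ε k) = L) (hA : ∀ k, Measurable (A k))
    (hAind : iIndepFun A P) {L' : Measure F} (hAlaw : ∀ k, P.map (A k) = L')
    (hAε : IndepFun (fun ω k => A k ω) (fun ω k => ε k ω) P)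
    {Φ : (E × E) × F → ℝ≥0∞} (hΦ : Measurable Φ) (hΦ1 : ∀ u, 1 ≤ Φ u) (i n : ℕ) :
    ∫⁻ ω, ∏ k ∈ Finset.range n, Φ ((ε (k + i) ω, ε (k + 1 + i) ω), A (k + 1 + i) ω) ∂P ≤
      2 * (∫⁻ ω, Φ ((ε 0 ω, ε 1 ω), A 1 ω) ^ 2 ∂P) ^ n := by
  have hΦ2 : Measurable fun u => Φ u ^ 2 := hΦ.pow_const 2
  let φ : ℕ → Ω → ℝ≥0∞ := fun k ω => Φ ((ε (k + i) ω, ε (k + 1 + i) ω), A (k + 1 + i) ω)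
  have hφ : ∀ k, Measurable (φ k) := fun k => hΦ.comp (((hε _).prodMk (hε _)).prodMk (hA _))
  have hpair : ∀ ω, ∏ k ∈ Finset.range (2 * n), φ k ω =
      (∏ j ∈ Finset.range n, φ (2 * j) ω) * ∏ j ∈ Finset.range n, φ (2 * j + 1) ω := fun ω => by
    clear * -
    induction n with
    | zero => simp
    | succ n ih =>
      rw [show 2 * (n + 1) = 2 * n + 1 + 1 by ring, Finset.prod_range_succ, Finset.prod_range_succ,
        ih, Finset.prod_range_succ, Finset.prod_range_succ]
      ring
  have hle : ∀ ω, ∏ k ∈ Finset.range n, φ k ω ≤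
      ∏ j ∈ Finset.range n, φ (2 * j) ω ^ 2 + ∏ j ∈ Finset.range n, φ (2 * j + 1) ω ^ 2 :=
    fun ω => by
    -- Since all factors are at least `1`, the product may be lengthened to `2 * n` terms, which
    -- gives exactly `n` even and `n` odd blocks whatever the parity of `n`.
    calc ∏ k ∈ Finset.range n, φ k ω ≤ ∏ k ∈ Finset.range (2 * n), φ k ω :=
          Finset.prod_le_prod_of_subset_of_one_le' (Finset.range_mono (by omega))
            fun _ _ _ => hΦ1 _
      _ ≤ _ := by
          rw [hpair, Finset.prod_pow, Finset.prod_pow]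
          exact mul_le_sq_add_sq _ _
  refine (lintegral_mono hle).trans ?_
  rw [lintegral_add_left (Finset.measurable_prod _ fun j _ => (hφ _).pow_const 2),
    lintegral_block hε hind hlaw hA hAind hAlaw hAε hΦ2, two_mul]
  refine add_le_add (le_of_eq ?_) (le_of_eq ?_)
  · exact lintegral_prod_blocks hε hind hlaw hA hAind hAlaw hAε hΦ2 i n
  · rw [← lintegral_prod_blocks hε hind hlaw hA hAind hAlaw hAε hΦ2 (i + 1) n]
    refine lintegral_congr fun ω => Finset.prod_congr rfl fun j _ => ?_
    simp only [φ, show 2 * j + (i + 1) = 2 * j + 1 + i by ring,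
      show 2 * j + 1 + (i + 1) = 2 * j + 1 + 1 + i by ring]

end Blocks

/-! ### Exponential rates -/

lemma limsup_log_div_lt_zero {u : ℕ → ℝ≥0∞} {D ρ : ℝ≥0∞} (hD : D ≠ ⊤) (hρ : ρ < 1)
    (hu : ∀ᶠ n in atTop, u n ≤ D * ρ ^ n) :
    limsup (fun n : ℕ => ENNReal.log (u n) / ((n : ℝ) : EReal)) atTop < 0 := by
  -- A rate strictly between `ρ` and `1` is positive even when `ρ = 0`, so its logarithm is finite;
  -- likewise `d` is positive even when `D = 0`.
  obtain ⟨ρ', hρρ', hρ'1⟩ := exists_between hρ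
  have hρ'0 : 0 < ρ' := zero_le.trans_lt hρρ'
  have hρ't : ρ' ≠ ⊤ := (hρ'1.trans ENNReal.one_lt_top).ne
  set d : ℝ := D.toReal + 1
  have hd : 0 < d := by positivity
  set c : ℝ := ρ'.toReal
  have hc : 0 < c := ENNReal.toReal_pos hρ'0.ne' hρ't
  have hc1 : c < 1 := by
    rw [← ENNReal.toReal_one]
    exact (ENNReal.toReal_lt_toReal hρ't ENNReal.one_ne_top).2 hρ'1
  have hle : ∀ᶠ n : ℕ in atTop, ENNReal.log (u n) / ((n : ℝ) : EReal) ≤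
      ((Real.log d / n + Real.log c : ℝ) : EReal) := by
    filter_upwards [hu, eventually_gt_atTop 0] with n hn hn0
    have hn' : (0 : ℝ) < n := by exact_mod_cast hn0
    have h1 : u n ≤ ENNReal.ofReal (d * c ^ n) := by
      rw [ENNReal.ofReal_mul hd.le, ENNReal.ofReal_pow hc.le, ENNReal.ofReal_toReal hρ't]
      refine hn.trans ?_
      gcongr
      rw [ENNReal.le_ofReal_iff_toReal_le hD hd.le]
      simp [d]
    have h2 : ENNReal.log (u n) ≤ ((Real.log d + n * Real.log c : ℝ) : EReal) := by
      refine (ENNReal.log_le_log h1).trans (le_of_eq ?_)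
      rw [ENNReal.log_ofReal_of_pos (by positivity), Real.log_mul hd.ne' (by positivity),
        Real.log_pow]
    refine (EReal.div_le_div_right_of_nonneg (by exact_mod_cast hn'.le) h2).trans (le_of_eq ?_)
    rw [← EReal.coe_div]
    congr 1
    field_simp
  have hlim : Tendsto (fun n : ℕ => ((Real.log d / n + Real.log c : ℝ) : EReal)) atTop
      (𝓝 ((0 + Real.log c : ℝ) : EReal)) :=
    (continuous_coe_real_ereal.tendsto _).comp
      ((tendsto_const_div_atTop_nhds_zero_nat _).add_const _)
  refine (limsup_le_limsup hle).trans_lt ?_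
  rw [hlim.limsup_eq, zero_add]
  exact_mod_cast Real.log_neg hc hc1

/-- `exp (t * (-log u)) = u ^ (-t)`. -/
lemma exp_mul_neg_log (u : ℝ≥0∞) (t : ℝ) :
    EReal.exp ((t : EReal) * -ENNReal.log u) = u ^ (-t) := by
  rw [ENNReal.rpow_eq_exp_mul_log, EReal.coe_neg, neg_mul, mul_neg]

/-! ### Estimates for the filtering model -/

section Model

variable {n p : ℕ} {f fs : Euc n → Euc n} {h hs : Euc n → Euc p} {v : Euc p → ℝ}
  {q : Euc n → Euc n → ℝ} {ψ : Euc n → ℝ} {a as : ℝ≥0} {b₀ b bs₀ bs μm μp : ℝ}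

/-- The density `(x, z) ↦ q(x, z - f x)` of the state kernel. -/
def stateDensity (f : Euc n → Euc n) (q : Euc n → Euc n → ℝ) (x z : Euc n) : ℝ≥0∞ :=
  ENNReal.ofReal (q x (z - f x))

lemma measurable_stateDensity (hf : Measurable f) (hq : Measurable (Function.uncurry q)) :
    Measurable (Function.uncurry (stateDensity f q)) :=
  (hq.comp (measurable_fst.prodMk (measurable_snd.sub (hf.comp measurable_fst)))).ennreal_ofReal

lemma stateKernel_apply (hf : Measurable f) (hq : Measurable (Function.uncurry q)) (x : Euc n) :
    stateKernel f q x = volume.withDensity (stateDensity f q x) := by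
  exact Kernel.withDensity_apply _ (measurable_stateDensity hf hq) x

lemma lintegral_stateDensity (hq : IsTransitionDensity q) (x : Euc n) :
    ∫⁻ z, stateDensity f q x z = 1 := by
  rw [← hq.lintegral_eq_one x]
  exact lintegral_sub_right_eq_self (fun u => ENNReal.ofReal (q x u)) (f x)

/-- A nonpositive slope would confine the whole space to a ball of radius `b₀`. -/
lemma CondE1.slope_pos (hE1 : CondE1 f h a b₀ b) (hn : 0 < n) : 0 < b := by
  by_contra! hb
  have : Nonempty (Fin n) := ⟨⟨0, hn⟩⟩
  obtain ⟨x, hx⟩ := NormedSpace.exists_lt_norm ℝ (Euc n) b₀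
  have h1 := hE1.inverse x 0
  rw [sub_zero] at h1
  have h2 : b * ‖h x - h 0‖ ≤ 0 := mul_nonpos_of_nonpos_of_nonneg hb (norm_nonneg _)
  linarith

/-- Consecutive states compatible with the observations up to `D` are linked by a noise of size
controlled by the noises of the observation process. -/
lemma norm_sub_le_of_mem_doeblinSet (hE1 : CondE1 f h a b₀ b) (hb : 0 < b)
    (hfs : LipschitzWith as fs) (hsurj : Function.Surjective hs)
    (hinv : ∀ x₁ x₂, ‖x₁ - x₂‖ ≤ bs₀ + bs * ‖hs x₁ - hs x₂‖) (hO1 : CondO1 f fs h hs)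
    {x₀ x₁ ζ x z : Euc n} {y₀ y₁ e₀ e₁ : Euc p} {s D : ℝ} (hy₀ : y₀ = hs x₀ + e₀)
    (hy₁ : y₁ = hs x₁ + e₁) (hx₁ : x₁ = fs x₀ + ζ) (hζ : ‖ζ‖ ≤ s)
    (hx : x ∈ doeblinSet h y₀ D) (hz : z ∈ doeblinSet h y₁ D) :
    ‖z - f x‖ ≤ (a + 1) * b₀ + (a + 1) * b * D + kappa f fs h hs b₀ b as + (1 + as) * bs₀ +
      as * bs * ‖e₀‖ + bs * ‖e₁‖ + s := by
  obtain ⟨w₀, hw₀⟩ := hE1.surjective y₀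
  obtain ⟨w₁, hw₁⟩ := hE1.surjective y₁
  obtain ⟨r₀, hr₀⟩ := hsurj y₀
  obtain ⟨r₁, hr₁⟩ := hsurj y₁
  have hf : ∀ u u', ‖f u - f u'‖ ≤ a * ‖u - u'‖ := fun u u' => hE1.lipschitz.norm_sub_le u u'
  have hfs' : ∀ u u', ‖fs u - fs u'‖ ≤ as * ‖u - u'‖ := fun u u' => hfs.norm_sub_le u u'
  have hF : ∀ u, ‖f u - fs u‖ ≤ supDist f fs := fun u => le_ciSup hO1.state u
  have hH : ∀ u, ‖hs u - h u‖ ≤ supDist hs h := fun u => by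
    have hbd : BddAbove (Set.range fun x => ‖hs x - h x‖) := by
      simpa only [norm_sub_rev] using hO1.obs
    exact le_ciSup hbd u
  have near : ∀ {u w y}, u ∈ doeblinSet h y D → h w = y → ‖u - w‖ ≤ b₀ + b * D := by
    intro u w y hu hw
    refine (hE1.inverse u w).trans ?_
    gcongr
    rw [hw]
    exact hu
  have cmp : ∀ {w r y}, h w = y → hs r = y → ‖w - r‖ ≤ b₀ + b * supDist hs h := by
    intro w r y hw hr
    refine (hE1.inverse w r).trans ?_
    gcongr
    rw [hw, ← hr]
    exact hH r
  have near' : ∀ {r u y e}, hs r = y → y = hs u + e → ‖r - u‖ ≤ bs₀ + bs * ‖e‖ := by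
    intro r u y e hr hy
    refine (hinv r u).trans (le_of_eq ?_)
    rw [hr, hy, add_sub_cancel_left]
  have e1 := near hz hw₁
  have e2 := cmp hw₁ hr₁
  have e3 := near' hr₁ hy₁
  have e4 : ‖x₁ - fs x₀‖ ≤ s := by rw [hx₁, add_sub_cancel_left]; exact hζ
  have e5 : ‖fs x₀ - fs r₀‖ ≤ as * (bs₀ + bs * ‖e₀‖) := (hfs' _ _).trans (by
    gcongr
    rw [norm_sub_rev]
    exact near' hr₀ hy₀)
  have e6 : ‖fs r₀ - fs w₀‖ ≤ as * (b₀ + b * supDist hs h) := (hfs' _ _).trans (by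
    gcongr
    rw [norm_sub_rev]
    exact cmp hw₀ hr₀)
  have e7 : ‖fs w₀ - f w₀‖ ≤ supDist f fs := by rw [norm_sub_rev]; exact hF _
  have e8 : ‖f w₀ - f x‖ ≤ a * (b₀ + b * D) := (hf _ _).trans (by
    gcongr
    rw [norm_sub_rev]
    exact near hx hw₀)
  have tri : ‖z - f x‖ ≤ ‖z - w₁‖ + ‖w₁ - r₁‖ + ‖r₁ - x₁‖ + ‖x₁ - fs x₀‖ + ‖fs x₀ - fs r₀‖ +
      ‖fs r₀ - fs w₀‖ + ‖fs w₀ - f w₀‖ + ‖f w₀ - f x‖ := by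
    have := norm_sub_le_norm_sub_add_norm_sub z w₁ (f x)
    have := norm_sub_le_norm_sub_add_norm_sub w₁ r₁ (f x)
    have := norm_sub_le_norm_sub_add_norm_sub r₁ x₁ (f x)
    have := norm_sub_le_norm_sub_add_norm_sub x₁ (fs x₀) (f x)
    have := norm_sub_le_norm_sub_add_norm_sub (fs x₀) (fs r₀) (f x)
    have := norm_sub_le_norm_sub_add_norm_sub (fs r₀) (fs w₀) (f x)
    have := norm_sub_le_norm_sub_add_norm_sub (fs w₀) (f w₀) (f x)
    linarith
  rw [kappa]
  linarith

lemma qMinus_mul_le (hG : CondG q ψ μm μp) {x u : Euc n} {ρ : ℝ} (hu : ‖u‖ ≤ ρ) :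
    qMinus μm ψ ρ ≤ q x u := by
  refine le_trans ?_ (hG.comparable.lower_le x u)
  rw [qMinus]
  refine mul_le_mul_of_nonneg_left ?_ hG.comparable.lower_pos.le
  refine ciInf_le (f := fun w : Metric.closedBall (0 : Euc n) ρ => ψ w) ?_
    ⟨u, mem_closedBall_zero_iff.2 hu⟩
  exact ⟨0, by rintro _ ⟨w, rfl⟩; exact hG.density.nonneg _⟩

/-- `q⁻` is antitone on `[0, ∞)`, and vanishes on the negative half-line, so it is measurable. -/
lemma measurable_qMinus (hG : CondG q ψ μm μp) : Measurable (qMinus μm ψ) := by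
  have hanti : AntitoneOn (qMinus μm ψ) (Set.Ici 0) := by
    intro ρ hρ ρ' _ hle
    have : Nonempty (Metric.closedBall (0 : Euc n) ρ) := ⟨⟨0, by simpa using hρ⟩⟩
    refine mul_le_mul_of_nonneg_left ?_ hG.comparable.lower_pos.le
    refine le_ciInf fun w => ?_
    refine ciInf_le (f := fun w : Metric.closedBall (0 : Euc n) ρ' => ψ w) ?_
      ⟨w, Metric.closedBall_subset_closedBall hle w.2⟩
    exact ⟨0, by rintro _ ⟨w, rfl⟩; exact hG.density.nonneg _⟩
  -- The ball is then empty and a real infimum over an empty type is `0`, so monotonicity fails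
  -- across `0` and the two half-lines are treated separately.
  have hneg : ∀ ρ, ρ < 0 → qMinus μm ψ ρ = 0 := by
    intro ρ hρ
    have : IsEmpty (Metric.closedBall (0 : Euc n) ρ) := by
      rw [Metric.closedBall_eq_empty.2 hρ]
      infer_instance
    rw [qMinus, Real.iInf_of_isEmpty, mul_zero]
  have hanti' : Antitone fun ρ => qMinus μm ψ (max ρ 0) := fun ρ ρ' hle =>
    hanti (Set.mem_Ici.2 (le_max_right _ _)) (Set.mem_Ici.2 (le_max_right _ _)) (max_le_max_right 0 hle)
  have heq : qMinus μm ψ = fun ρ => if 0 ≤ ρ then qMinus μm ψ (max ρ 0) else 0 := by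
    funext ρ
    split_ifs with hρ
    · rw [max_eq_left hρ]
    · exact hneg ρ (not_le.1 hρ)
  rw [heq]
  exact Measurable.ite measurableSet_Ici hanti'.measurable measurable_const

lemma measurableSet_doeblinSet (hh : Measurable h) (y : Euc p) (D : ℝ) :
    MeasurableSet (doeblinSet h y D) :=
  measurableSet_le (hh.sub_const y).norm measurable_const

lemma measurable_likelihood (hh : Measurable h) (hv : Measurable v) (y : Euc p) :
    Measurable fun x => likelihood h v x y :=
  (hv.comp (hh.const_sub y)).ennreal_ofReal

/-- The likelihood is bounded below on the sets `C(y, Δ)`. -/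
lemma exists_le_likelihood (hE2 : CondE2 v) (h : Euc n → Euc p) (D : ℝ) :
    ∃ w : ℝ≥0∞, w ≠ 0 ∧ w ≠ ⊤ ∧ ∀ y, ∀ x ∈ doeblinSet h y D, w ≤ likelihood h v x y := by
  obtain ⟨c, hc, hcv⟩ := hE2.inf_pos _ (isCompact_closedBall (0 : Euc p) D)
  refine ⟨ENNReal.ofReal c, (ENNReal.ofReal_pos.2 hc).ne', ENNReal.ofReal_ne_top,
    fun y x hx => ENNReal.ofReal_le_ofReal (hcv _ ?_)⟩
  rw [mem_closedBall_zero_iff, norm_sub_rev]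
  exact hx

/-- The volume of the sets `C(y, Δ)` is bounded below. -/
lemma exists_le_volume_doeblinSet (hE1 : CondE1 f h a b₀ b) {D : ℝ} (hD : 0 < D) :
    ∃ c : ℝ≥0∞, c ≠ 0 ∧ c ≠ ⊤ ∧ ∀ y, c ≤ volume (doeblinSet h y D) := by
  obtain ⟨δ, hδ, hδD⟩ := Metric.uniformContinuous_iff.1 hE1.uniformContinuous D hD
  refine ⟨volume (Metric.ball (0 : Euc n) δ), (Metric.measure_ball_pos _ _ hδ).ne',
    measure_ball_lt_top.ne, fun y => ?_⟩
  obtain ⟨z, rfl⟩ := hE1.surjective y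
  rw [← Measure.addHaar_ball_center volume z δ]
  refine measure_mono fun x hx => ?_
  have := hδD (Metric.mem_ball.1 hx)
  rw [dist_eq_norm] at this
  exact this.le

/-- Outside `C(y, D)` with `D` large, the likelihood is small. -/
lemma exists_likelihood_mul_exitWeight_le (hE2 : CondE2 v) (h : Euc n → Euc p) :
    ∃ V : ℝ≥0∞, V ≠ 0 ∧ V ≠ ⊤ ∧ ∀ θ : ℝ≥0∞, θ ≠ 0 → θ ≠ ⊤ → ∃ D : ℝ, 0 < D ∧
      ∀ y x, likelihood h v x y * exitWeight θ (doeblinSet h y D) x ^ 2 ≤ V := by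
  obtain ⟨B, hB⟩ := hE2.bounded
  -- `V` is fixed before `θ`; only the radius depends on `θ`. Off the set the squared exit weight is
  -- `θ ^ 4`, so `v` has to fall below `V / θ ^ 4`.
  have hV : 0 < max B 1 := lt_max_of_lt_right one_pos
  refine ⟨ENNReal.ofReal (max B 1), (ENNReal.ofReal_pos.2 hV).ne', ENNReal.ofReal_ne_top,
    fun θ hθ hθ' => ?_⟩
  set c : ℝ≥0∞ := ENNReal.ofReal (max B 1) / (θ ^ 2) ^ 2
  have hc : c ≠ 0 := ENNReal.div_ne_zero.2 ⟨(ENNReal.ofReal_pos.2 hV).ne', by finiteness⟩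
  have hc' : c ≠ ⊤ := ENNReal.div_ne_top ENNReal.ofReal_ne_top (by positivity)
  have hev := hE2.tendsto_zero.eventually_lt_const (ENNReal.toReal_pos hc hc')
  obtain ⟨K, hK, hKv⟩ := mem_cocompact.1 hev
  obtain ⟨D, hD⟩ := hK.isBounded.subset_closedBall (0 : Euc p)
  refine ⟨max D 1, lt_max_of_lt_right one_pos, fun y x => ?_⟩
  unfold exitWeight
  split_ifs with hx
  · rw [one_pow, mul_one]
    exact ENNReal.ofReal_le_ofReal ((hB _).trans (le_max_left _ _))
  · have hK' : y - h x ∉ K := fun hmem => hx <| by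
      have := mem_closedBall_zero_iff.1 (hD hmem)
      rw [norm_sub_rev] at this
      exact this.trans (le_max_left _ _)
    have hlt : v (y - h x) < c.toReal := hKv hK'
    calc likelihood h v x y * (θ ^ 2) ^ 2 ≤ c * (θ ^ 2) ^ 2 := by
          gcongr
          exact ENNReal.ofReal_le_of_le_toReal hlt.le
      _ = _ := ENNReal.div_mul_cancel (by positivity) (by finiteness)

/-- Large values of the transition density carry little mass, uniformly. -/
lemma exists_lintegral_stateDensity_mul_exitWeight_le (hf : Measurable f) (hG : CondG q ψ μm μp)
    {θ : ℝ≥0∞} (hθ : θ ≠ 0) (hθ' : θ ≠ ⊤) : ∃ M : ℝ≥0∞, M ≠ 0 ∧ M ≠ ⊤ ∧ ∀ x,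
      ∫⁻ z, stateDensity f q x z * exitWeight θ {z | stateDensity f q x z ≤ M} z ≤ 2 := by
  -- After translation by `f x`, every transition density lies below the single integrable function
  -- `F`. Absolute continuity of its integral makes the mass on `{M ≤ F}` at most `1 / θ ^ 2`,
  -- uniformly in `x`; Markov's inequality supplies `M`.
  set F : Euc n → ℝ≥0∞ := fun u => ENNReal.ofReal (μp * ψ u)
  have hF : Measurable F := (hG.density.measurable.const_mul μp).ennreal_ofReal
  have hFint : ∫⁻ u, F u ≠ ⊤ := by
    simp only [F, ENNReal.ofReal_mul hG.comparable.upper_pos.le]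
    rw [lintegral_const_mul _ hG.density.measurable.ennreal_ofReal, hG.density.lintegral_eq_one]
    finiteness
  obtain ⟨δ, hδ, hδF⟩ := exists_pos_setLIntegral_lt_of_measure_lt hFint
    (ε := 1 / θ ^ 2) (ENNReal.div_ne_zero.2 ⟨one_ne_zero, by finiteness⟩)
  set I := ∫⁻ u, F u
  set d := min δ 1
  have hd : d ≠ 0 := (lt_min hδ one_pos).ne'
  have hd' : d ≠ ⊤ := ((min_le_right _ _).trans_lt ENNReal.one_lt_top).ne
  set M : ℝ≥0∞ := I / d + 1
  have hM : M ≠ 0 := (one_pos.trans_le le_add_self).ne'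
  have hM' : M ≠ ⊤ := ENNReal.add_ne_top.2 ⟨ENNReal.div_ne_top hFint hd, ENNReal.one_ne_top⟩
  have hvol : volume {u | M ≤ F u} < δ := by
    refine (meas_ge_le_lintegral_div hF.aemeasurable hM hM').trans_lt
      (lt_of_lt_of_le ?_ (min_le_left δ 1))
    refine ENNReal.div_lt_of_lt_mul ?_
    rw [mul_add, mul_one, ENNReal.mul_div_cancel hd hd']
    exact ENNReal.lt_add_right hFint hd
  have hset : MeasurableSet {u | M ≤ F u} := measurableSet_le measurable_const hF
  set H : Euc n → ℝ≥0∞ := {u | M ≤ F u}.indicator F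
  have hH : ∫⁻ u, H u ≤ 1 / θ ^ 2 := by
    rw [lintegral_indicator hset]
    exact (hδF _ hvol).le
  refine ⟨M, hM, hM', fun x => ?_⟩
  have hp : Measurable (stateDensity f q x) :=
    (measurable_stateDensity hf hG.transition.measurable).of_uncurry_left
  calc ∫⁻ z, stateDensity f q x z * exitWeight θ {z | stateDensity f q x z ≤ M} z
      ≤ ∫⁻ z, (stateDensity f q x z + θ ^ 2 * H (z - f x)) := by
        refine lintegral_mono fun z => ?_
        unfold exitWeight
        split_ifs with hz
        · rw [mul_one]
          exact le_self_add
        · have hle : stateDensity f q x z ≤ F (z - f x) :=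
            ENNReal.ofReal_le_ofReal (hG.comparable.le_upper _ _)
          have hmem : z - f x ∈ {u | M ≤ F u} := (not_le.1 hz).le.trans hle
          simp only [H, Set.indicator_of_mem hmem]
          rw [mul_comm]
          exact le_add_left (by gcongr)
    _ = 1 + θ ^ 2 * ∫⁻ u, H u := by
        rw [lintegral_add_left hp, lintegral_stateDensity hG.transition,
          lintegral_const_mul' _ _ (by finiteness),
          lintegral_sub_right_eq_self (fun u => H u) (f x)]
    _ ≤ 1 + θ ^ 2 * (1 / θ ^ 2) := by gcongr
    _ = 2 := by
        rw [ENNReal.mul_div_cancel (by positivity) (by finiteness), one_add_one_eq_two]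

end Model

/-! ### Fractional powers and negative moments -/

lemma min_one_le_rpow (R : ℝ≥0∞) {s : ℝ} (hs : 0 < s) (hs1 : s ≤ 1) : min 1 R ≤ R ^ s := by
  rcases le_total R 1 with h | h
  · refine (min_le_right _ _).trans ?_
    simpa using ENNReal.rpow_le_rpow_of_exponent_ge h hs1
  · refine (min_le_left _ _).trans ?_
    simpa using ENNReal.rpow_le_rpow h hs.le

/-- Splitting of a fractional power of the ratio controlling the trajectories with many exits. -/
lemma min_one_ratio_le {V w c θ I J Λ : ℝ≥0∞} {s : ℝ} (hs : 0 < s) (hs1 : s ≤ 1)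
    (hw' : w ≠ ⊤) (hc' : c ≠ ⊤) (hθ : 1 ≤ θ)
    (hI : I ≠ ⊤) (hJ : J ≠ ⊤) (hΛ : Λ ≠ ⊤) (m : ℕ) :
    min 1 (V ^ 2 * (2 * V) ^ (2 * (m + 1)) / θ ^ (m + 1) /
      ((I * (w * ((w * c) ^ m * Λ))) * (J * (w * ((w * c) ^ m * Λ))))) ≤
    (V ^ 2 * (2 * V) ^ 2 * w⁻¹ ^ 2) ^ s * (((2 * V) ^ 2 * (w⁻¹ * c⁻¹) ^ 2) ^ s * (θ ^ s)⁻¹) ^ m *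
      (I ^ (-(4 * s)) + J ^ (-(4 * s)) + Λ ^ (-(4 * s))) := by
  generalize 2 * V = T
  set κ₀ := V ^ 2 * T ^ 2 * w⁻¹ ^ 2
  set κ₁ := T ^ 2 * (w⁻¹ * c⁻¹) ^ 2
  have hinv : ∀ {a b : ℝ≥0∞}, a ≠ ⊤ → b ≠ ⊤ → (a * b)⁻¹ = a⁻¹ * b⁻¹ := fun ha hb =>
    ENNReal.mul_inv (Or.inr hb) (Or.inl ha)
  have hR : V ^ 2 * T ^ (2 * (m + 1)) / θ ^ (m + 1) /
      ((I * (w * ((w * c) ^ m * Λ))) * (J * (w * ((w * c) ^ m * Λ)))) ≤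
      κ₀ * (κ₁ * θ⁻¹) ^ m * ((I⁻¹ * J⁻¹) * (Λ⁻¹ * Λ⁻¹)) := by
    rw [div_eq_mul_inv, div_eq_mul_inv, hinv (by finiteness) (by finiteness),
      hinv hI (by finiteness), hinv hJ (by finiteness), hinv hw' (by finiteness),
      hinv (by finiteness) hΛ, ENNReal.inv_pow, ENNReal.inv_pow, hinv hw' hc']
    -- One of the `m + 1` factors `θ⁻¹` is dropped, so that the exponents of `θ` and of the link
    -- bounds agree.
    calc _ = θ⁻¹ * (κ₀ * (κ₁ * θ⁻¹) ^ m * ((I⁻¹ * J⁻¹) * (Λ⁻¹ * Λ⁻¹))) := by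
          simp only [κ₀, κ₁]; ring
      _ ≤ _ := mul_le_of_le_one_left' (ENNReal.inv_le_one.2 hθ)
  refine (min_one_le_rpow _ hs hs1).trans ((ENNReal.rpow_le_rpow hR hs.le).trans ?_)
  have hmul : ∀ a b : ℝ≥0∞, (a * b) ^ s = a ^ s * b ^ s := fun a b =>
    ENNReal.mul_rpow_of_nonneg _ _ hs.le
  have hpow : ∀ a : ℝ≥0∞, (a⁻¹ ^ s) ^ 4 = a ^ (-(4 * s)) := fun a => by
    rw [ENNReal.inv_rpow, ← ENNReal.rpow_neg, ← ENNReal.rpow_natCast, ← ENNReal.rpow_mul]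
    congr 1
    push_cast
    ring
  -- The initial masses and the link bounds are dependent, so their product is separated by fourth
  -- powers; hence the exponent `4 * s`.
  have h4 : ∀ a b c : ℝ≥0∞, (a * b) * (c * c) ≤ a ^ 4 + b ^ 4 + c ^ 4 := fun a b c => by
    calc (a * b) * (c * c) ≤ (a * b) ^ 2 + (c * c) ^ 2 := mul_le_sq_add_sq _ _
      _ = a ^ 2 * b ^ 2 + c ^ 4 := by ring
      _ ≤ (a ^ 2) ^ 2 + (b ^ 2) ^ 2 + c ^ 4 := by gcongr; exact mul_le_sq_add_sq _ _
      _ = _ := by ring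
  have hpm : ∀ a : ℝ≥0∞, (a ^ m) ^ s = (a ^ s) ^ m := fun a => by
    rw [← ENNReal.rpow_natCast, ← ENNReal.rpow_natCast, ← ENNReal.rpow_mul, ← ENNReal.rpow_mul,
      mul_comm]
  clear_value κ₀ κ₁
  rw [hmul, hmul κ₀, hpm, hmul κ₁, hmul (I⁻¹ * J⁻¹), hmul I⁻¹, hmul Λ⁻¹, ENNReal.inv_rpow θ]
  gcongr
  rw [← hpow, ← hpow, ← hpow]
  exact h4 _ _ _

/-- Where `Z ≤ 1` the negative power increases with the exponent; where `Z ≥ 1` it is at most `1`,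
and so below the exponential of a nonnegative quantity. -/
lemma lintegral_rpow_neg_lt_top {Ω : Type*} [MeasurableSpace Ω] {P : Measure Ω}
    {Z : Ω → ℝ≥0∞} {t u : ℝ} (h : negLogMoment P Z t < ⊤) (hu : 0 ≤ u) (hut : u ≤ t) :
    ∫⁻ ω, Z ω ^ (-u) ∂P < ⊤ := by
  refine (lintegral_mono fun ω => ?_).trans_lt h
  have ht : (0 : EReal) ≤ (t : EReal) := by exact_mod_cast hu.trans hut
  rcases le_total (Z ω) 1 with h1 | h1
  · calc Z ω ^ (-u) ≤ Z ω ^ (-t) :=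
          ENNReal.rpow_le_rpow_of_exponent_ge h1 (neg_le_neg hut)
      _ = EReal.exp ((t : EReal) * -ENNReal.log (Z ω)) := (exp_mul_neg_log _ _).symm
      _ ≤ _ := EReal.exp_monotone (mul_le_mul_of_nonneg_left (le_max_left _ _) ht)
  · calc Z ω ^ (-u) ≤ 1 := by
          simpa using ENNReal.rpow_le_rpow_of_exponent_le h1 (neg_nonpos.2 hu)
      _ ≤ _ := by
        rw [EReal.one_le_exp_iff]
        exact mul_nonneg ht (le_max_right _ _)

lemma one_add_sq_max_le (x : ℝ≥0∞) : max 1 x ^ 2 ≤ 1 + x ^ 2 := by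
  rcases le_total 1 x with h | h
  · rw [max_eq_right h]; exact le_add_self
  · rw [max_eq_left h, one_pow]; exact le_self_add

/-! ### Measurability, link bounds and levels -/

section Model

variable {n p : ℕ}

lemma isMarkovKernel_stateKernel {f : Euc n → Euc n} {q : Euc n → Euc n → ℝ} (hf : Measurable f)
    (hq : IsTransitionDensity q) : IsMarkovKernel (stateKernel f q) :=
  ⟨fun x => ⟨by
    rw [stateKernel_apply hf hq.measurable, withDensity_apply _ MeasurableSet.univ,
      setLIntegral_univ, lintegral_stateDensity hq]⟩⟩

lemma measurable_initialMass {Ω : Type*} [MeasurableSpace Ω] {h : Euc n → Euc p} {v : Euc p → ℝ}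
    (hh : Measurable h) (hv : Measurable v) (Q : Kernel (Euc n) (Euc n)) [IsSFiniteKernel Q]
    (ν : Measure (Euc n)) [SFinite ν] {Y₀ Y₁ : Ω → Euc p} (hY₀ : Measurable Y₀)
    (hY₁ : Measurable Y₁) (D : ℝ) :
    Measurable fun ω => initialMass Q (likelihood h v) ν (doeblinSet h (Y₁ ω) D) (Y₀ ω) := by
  have h1 : Measurable fun u : Ω × Euc n => likelihood h v u.2 (Y₀ u.1) :=
    (hv.comp ((hY₀.comp measurable_fst).sub (hh.comp measurable_snd))).ennreal_ofReal
  have hset : MeasurableSet {u : (Ω × Euc n) × Euc n | ‖h u.2 - Y₁ u.1.1‖ ≤ D} :=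
    measurableSet_le ((hh.comp measurable_snd).sub (hY₁.comp measurable_fst.fst)).norm
      measurable_const
  have h2 : Measurable fun u : Ω × Euc n => Q u.2 (doeblinSet h (Y₁ u.1) D) :=
    Kernel.measurable_kernel_prodMk_left (κ := Q.prodMkLeft Ω) hset
  exact (h1.mul h2).lintegral_prod_right'

lemma likelihood_lintegral_ne_top {h : Euc n → Euc p} {v : Euc p → ℝ} {V : ℝ≥0∞} (hV : V ≠ ⊤)
    {y : Euc p} (hle : ∀ x, likelihood h v x y ≤ V) (Q : Kernel (Euc n) (Euc n)) [IsMarkovKernel Q]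
    (ν : Measure (Euc n)) [IsProbabilityMeasure ν] (C : Set (Euc n)) :
    initialMass Q (likelihood h v) ν C y ≠ ⊤ := by
  refine ne_top_of_le_ne_top hV ?_
  calc initialMass Q (likelihood h v) ν C y ≤ ∫⁻ _, V * 1 ∂ν :=
        lintegral_mono fun x => mul_le_mul' (hle x) prob_le_one
    _ = V := by simp

/-- The lower bound `q⁻(…)` of the transition density between two `C`-sets, as a function of the
noises of the observation process. -/
def linkBound (μm : ℝ) (ψ : Euc n → ℝ) (a : ℝ≥0) (b₀ b κ : ℝ) (as : ℝ≥0) (bs : ℝ) (gp : ℝ → ℝ)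
    (D : ℝ) (u : (Euc p × Euc p) × ℝ) : ℝ≥0∞ :=
  ENNReal.ofReal (qMinus μm ψ ((a + 1) * b₀ + (a + 1) * b * D + κ + 2 * as * bs +
    as * bs * ‖u.1.1‖ + bs * ‖u.1.2‖ + gp u.2))

lemma measurable_linkBound {q : Euc n → Euc n → ℝ} {ψ : Euc n → ℝ} {μm μp : ℝ}
    (hG : CondG q ψ μm μp) {gp : ℝ → ℝ} (hgp : Measurable gp) (a : ℝ≥0) (b₀ b κ : ℝ) (as : ℝ≥0)
    (bs D : ℝ) :
    Measurable (linkBound (p := p) μm ψ a b₀ b κ as bs gp D) := by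
  refine ((measurable_qMinus hG).comp ?_).ennreal_ofReal
  have h3 : Measurable fun u : (Euc p × Euc p) × ℝ => gp u.2 := hgp.comp measurable_snd
  have h1 : Measurable fun u : (Euc p × Euc p) × ℝ => ‖u.1.1‖ := measurable_fst.fst.norm
  have h2 : Measurable fun u : (Euc p × Euc p) × ℝ => ‖u.1.2‖ := measurable_fst.snd.norm
  exact ((((h1.const_mul _).const_add _).add (h2.const_mul _)).add h3)

/-- Turns (O4) into finiteness of negative moments of the link bound, the form used in all
estimates. -/
lemma logMGF_zStar_lt_top_iff {Ω : Type*} [MeasurableSpace Ω] (P : Measure Ω) (μm : ℝ)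
    (ψ : Euc n → ℝ) (a : ℝ≥0) (b₀ b κ : ℝ) (as : ℝ≥0) (bs : ℝ) (gp : ℝ → ℝ) (D : ℝ)
    (e₀ e₁ : Ω → Euc p) (α : Ω → ℝ) (t : ℝ) :
    logMGF P (fun ω => zStar μm ψ a b₀ b κ as bs D (e₀ ω) (e₁ ω) (gp (α ω))) t < ⊤ ↔
      ∫⁻ ω, linkBound μm ψ a b₀ b κ as bs gp D ((e₀ ω, e₁ ω), α ω) ^ (-t) ∂P < ⊤ := by
  rw [logMGF, ENNReal.log_lt_top_iff]
  simp only [zStar, exp_mul_neg_log]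
  rfl

end Model

/-- A small contraction from a nonzero common part. -/
lemma exists_contraction {u : ℝ≥0∞} (hu : u ≠ 0) : ∃ r : ℝ≥0∞, r < 1 ∧ 1 ≤ r ^ 4 + u := by
  refine ⟨(1 - u) ^ ((1 : ℝ) / 4), ?_, ?_⟩
  · exact ENNReal.rpow_lt_one (ENNReal.sub_lt_self ENNReal.one_ne_top one_ne_zero hu) (by norm_num)
  · rw [← ENNReal.rpow_natCast, ← ENNReal.rpow_mul]
    norm_num
    exact le_tsub_add

/-- A random variable with a finite negative moment is bounded below off a small event. -/
lemma exists_level {Ω : Type*} [MeasurableSpace Ω] {P : Measure Ω} {Z : Ω → ℝ≥0∞}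
    (hZ : Measurable Z) {t : ℝ} (ht : 0 < t) (h : ∫⁻ ω, Z ω ^ (-t) ∂P < ⊤) {η : ℝ≥0∞}
    (hη : η ≠ 0) : ∃ c : ℝ≥0∞, c ≠ 0 ∧ P {ω | Z ω < c} ≤ η := by
  set K := ∫⁻ ω, Z ω ^ (-t) ∂P
  set d := min η 1
  have hd : d ≠ 0 := (lt_min (pos_iff_ne_zero.2 hη) one_pos).ne'
  have hd' : d ≠ ⊤ := ((min_le_right _ _).trans_lt ENNReal.one_lt_top).ne
  set B := K / d + 1
  have hB : B ≠ 0 := (one_pos.trans_le le_add_self).ne'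
  have hB' : B ≠ ⊤ := ENNReal.add_ne_top.2 ⟨ENNReal.div_ne_top h.ne hd, ENNReal.one_ne_top⟩
  refine ⟨B ^ (-t⁻¹), (ENNReal.rpow_pos (pos_iff_ne_zero.2 hB) hB').ne', ?_⟩
  have hsub : {ω | Z ω < B ^ (-t⁻¹)} ⊆ {ω | B ≤ Z ω ^ (-t)} := fun ω hω => by
    have h1 : Z ω ^ t ≤ (B ^ (-t⁻¹)) ^ t := ENNReal.rpow_le_rpow (le_of_lt hω) ht.le
    rw [← ENNReal.rpow_mul, neg_mul, inv_mul_cancel₀ ht.ne', ENNReal.rpow_neg_one] at h1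
    change B ≤ Z ω ^ (-t)
    rw [ENNReal.rpow_neg]
    exact ENNReal.le_inv_iff_le_inv.1 h1
  calc P {ω | Z ω < B ^ (-t⁻¹)} ≤ P {ω | B ≤ Z ω ^ (-t)} := measure_mono hsub
    _ ≤ K / B := meas_ge_le_lintegral_div (hZ.pow_const _).aemeasurable hB hB'
    _ ≤ d := by
        refine ENNReal.div_le_of_le_mul ?_
        rw [mul_add, mul_one, ENNReal.mul_div_cancel hd hd']
        exact le_self_add
    _ ≤ η := min_le_left _ _

end

/-! ### Estimates along the observation process -/

section Observations

variable {n p : ℕ} {Ω : Type*} [MeasurableSpace Ω] {P : Measure Ω} [IsProbabilityMeasure P]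
  {f fs : Euc n → Euc n} {h hs : Euc n → Euc p} {a as : ℝ≥0} {b₀ b bs₀ bs : ℝ}
  {q qs : Euc n → Euc n → ℝ} {ψ ψs : Euc n → ℝ} {μm μp μsm μsp : ℝ} {gs : Euc n → ℝ → Euc n}
  {X ζ : ℕ → Ω → Euc n} {Y ε : ℕ → Ω → Euc p} {A : ℕ → Ω → ℝ}

lemma ObservationSystem.measurable_Y
    (hobs : ObservationSystem P fs hs as bs₀ bs qs ψs μsm μsp gs X ζ Y ε A) (k : ℕ) :
    Measurable (Y k) := by
  rw [show Y k = fun ω => hs (X k ω) + ε k ω from funext (hobs.obs_eq k)]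
  exact (hobs.measurable_h.comp (hobs.measurable_X k)).add (hobs.measurable_ε k)

lemma ObservationSystem.ae_mem_Ioo
    (hobs : ObservationSystem P fs hs as bs₀ bs qs ψs μsm μsp gs X ζ Y ε A) (k : ℕ) :
    ∀ᵐ ω ∂P, A k ω ∈ Set.Ioo (0 : ℝ) 1 := by
  have h1 : ∀ᵐ x ∂(P.map (A k)), x ∈ Set.Ioo (0 : ℝ) 1 := by
    rw [hobs.A_uniform k]
    exact ae_cond_mem measurableSet_Ioo
  exact ae_of_ae_map (hobs.measurable_A k).aemeasurable h1

/-- The density between two consecutive `C`-sets is at least `linkBound` at an enlarged radius. -/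
lemma ObservationSystem.ae_linkBound_le
    (hobs : ObservationSystem P fs hs as bs₀ bs qs ψs μsm μsp gs X ζ Y ε A)
    (hE1 : CondE1 f h a b₀ b) (hb : 0 < b) (hG : CondG q ψ μm μp) (hO1 : CondO1 f fs h hs)
    {gp : ℝ → ℝ} (hO3 : CondO3 gs gp) :
    ∀ᵐ ω ∂P, ∀ (D : ℝ) (k : ℕ), ∀ x ∈ doeblinSet h (Y k ω) D, ∀ z ∈ doeblinSet h (Y (k + 1) ω) D,
      linkBound μm ψ a b₀ b (kappa f fs h hs b₀ b as) as bs gp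
        (D + (1 + as) * bs₀ / ((a + 1) * b)) ((ε k ω, ε (k + 1) ω), A (k + 1) ω) ≤
      stateDensity f q x z := by
  filter_upwards [ae_all_iff.2 hobs.noise_eq, ae_all_iff.2 hobs.ae_mem_Ioo] with ω hζ hA D k x hx z
    hz
  refine ENNReal.ofReal_le_ofReal (qMinus_mul_le hG ?_)
  refine (norm_sub_le_of_mem_doeblinSet (s := gp (A (k + 1) ω)) hE1 hb hobs.lipschitz hobs.surjective hobs.inverse hO1
    (hobs.obs_eq k ω) (hobs.obs_eq (k + 1) ω) (hobs.state_eq k ω)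
    (by rw [hζ k]; exact hO3.bound _ _ (hA (k + 1))) hx hz).trans ?_
  -- The triangle inequality yields `(1 + as) * bs₀`, whereas `linkBound` contains `2 * as * bs`.
  -- The former is absorbed by enlarging the radius, which is harmless because (O4) covers every
  -- radius; the latter is nonnegative and is given away.
  have h0 : 0 ≤ 2 * (as : ℝ) * bs := by
    have := hobs.inv_slope_pos.le
    positivity
  have h1 : ((a : ℝ) + 1) * b * (D + (1 + as) * bs₀ / ((a + 1) * b)) =
      (a + 1) * b * D + (1 + as) * bs₀ := by
    have : ((a : ℝ) + 1) * b ≠ 0 := by positivity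
    field_simp
  rw [h1]
  dsimp only
  linarith

/-- Exponential bound for multiplicative functionals of the noises of the observation process. -/
lemma ObservationSystem.lintegral_prod_le
    (hobs : ObservationSystem P fs hs as bs₀ bs qs ψs μsm μsp gs X ζ Y ε A)
    {Φ : (Euc p × Euc p) × ℝ → ℝ≥0∞} (hΦ : Measurable Φ) (hΦ1 : ∀ u, 1 ≤ Φ u) (i m : ℕ) :
    ∫⁻ ω, ∏ k ∈ Finset.range m, Φ ((ε (i + k) ω, ε (i + k + 1) ω), A (i + k + 1) ω) ∂P ≤
      2 * (∫⁻ ω, Φ ((ε 0 ω, ε 1 ω), A 1 ω) ^ 2 ∂P) ^ m := by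
  have h1 := lintegral_prod_one_dependent_le hobs.measurable_ε hobs.ε_indep
    (fun k => (hobs.ε_ident k).map_eq) hobs.measurable_A hobs.A_indep
    (L' := ProbabilityTheory.cond volume (Set.Ioo (0 : ℝ) 1)) (fun k => hobs.A_uniform k)
    hobs.A_indep_ε hΦ hΦ1 i m
  have h2 : ∀ k, i + k + 1 = k + 1 + i := fun k => by ring
  simp only [h2]
  simpa only [add_comm i] using h1

lemma pow_inactiveCount_eq_prod (t : ℝ≥0∞) (act : ℕ → Prop) [DecidablePred act] (N : ℕ) :
    t ^ (4 * inactiveCount act 0 N) = ∏ k ∈ Finset.range N, if act k then 1 else t ^ 4 := by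
  rw [inactiveCount, pow_mul, ← Finset.prod_pow_eq_pow_sum]
  refine Finset.prod_congr rfl fun k _ => ?_
  rw [zero_add]
  split_ifs <;> simp

/-- Inactive transitions have small exponential moments. -/
lemma ObservationSystem.lintegral_pow_inactiveCount_le
    (hobs : ObservationSystem P fs hs as bs₀ bs qs ψs μsm μsp gs X ζ Y ε A)
    {Z : (Euc p × Euc p) × ℝ → ℝ≥0∞} (hZ : Measurable Z) {c₀ : ℝ≥0∞}
    (hc₀ : P {ω | Z ((ε 0 ω, ε 1 ω), A 1 ω) < c₀} ≤ (4 ^ 8)⁻¹) (N : ℕ) :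
    ∫⁻ ω, 4 ^ (4 * inactiveCount
        (fun k => c₀ ≤ Z ((ε k ω, ε (k + 1) ω), A (k + 1) ω)) 0 N) / 4 ^ N ∂P ≤
      2 * 2⁻¹ ^ N := by
  classical
  set Φ : (Euc p × Euc p) × ℝ → ℝ≥0∞ := fun u => if c₀ ≤ Z u then 1 else 4 ^ 4
  have hΦ : Measurable Φ :=
    Measurable.ite (measurableSet_le measurable_const hZ) measurable_const measurable_const
  have hΦ1 : ∀ u, 1 ≤ Φ u := fun u => by
    simp only [Φ]
    split_ifs
    exacts [le_rfl, one_le_pow₀ (by norm_num)]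
  have hu : Measurable fun ω => Z ((ε 0 ω, ε 1 ω), A 1 ω) :=
    hZ.comp (((hobs.measurable_ε 0).prodMk (hobs.measurable_ε 1)).prodMk (hobs.measurable_A 1))
  have hset : MeasurableSet {ω | Z ((ε 0 ω, ε 1 ω), A 1 ω) < c₀} :=
    measurableSet_lt hu measurable_const
  -- The one-dependent bound squares `Φ`, so an inactive transition weighs `4 ^ 8`, which the
  -- probability in `hc₀` compensates. The rate becomes `2 / 4`.
  have hK : ∫⁻ ω, Φ ((ε 0 ω, ε 1 ω), A 1 ω) ^ 2 ∂P ≤ 2 := by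
    calc ∫⁻ ω, Φ ((ε 0 ω, ε 1 ω), A 1 ω) ^ 2 ∂P
        ≤ ∫⁻ ω, (1 + {ω | Z ((ε 0 ω, ε 1 ω), A 1 ω) < c₀}.indicator (fun _ => 4 ^ 8) ω) ∂P := by
          refine lintegral_mono fun ω => ?_
          simp only [Φ]
          split_ifs with hω
          · rw [one_pow]
            exact le_self_add
          · rw [Set.indicator_of_mem (show ω ∈ {ω | Z ((ε 0 ω, ε 1 ω), A 1 ω) < c₀} from
              not_le.1 hω), ← pow_mul]
            exact le_add_self
      _ = 1 + 4 ^ 8 * P {ω | Z ((ε 0 ω, ε 1 ω), A 1 ω) < c₀} := by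
          rw [lintegral_add_left measurable_const, lintegral_indicator_const hset]
          simp
      _ ≤ 1 + 4 ^ 8 * (4 ^ 8)⁻¹ := by gcongr
      _ = 2 := by
          rw [ENNReal.mul_inv_cancel (by positivity) (by finiteness), one_add_one_eq_two]
  have h4 : (2 : ℝ≥0∞) * (4 : ℝ≥0∞)⁻¹ = 2⁻¹ := by
    rw [show (4 : ℝ≥0∞) = 2 * 2 by norm_num,
      ENNReal.mul_inv (Or.inl two_ne_zero) (Or.inl ENNReal.ofNat_ne_top), ← mul_assoc,
      ENNReal.mul_inv_cancel two_ne_zero ENNReal.ofNat_ne_top, one_mul]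
  simp only [div_eq_mul_inv, pow_inactiveCount_eq_prod]
  rw [lintegral_mul_const' _ _ (ENNReal.inv_ne_top.2 (by positivity))]
  have := hobs.lintegral_prod_le hΦ hΦ1 0 N
  simp only [zero_add] at this
  calc _ ≤ 2 * (∫⁻ ω, Φ ((ε 0 ω, ε 1 ω), A 1 ω) ^ 2 ∂P) ^ N * (4 ^ N)⁻¹ :=
        mul_le_mul' this le_rfl
    _ ≤ 2 * 2 ^ N * (4 ^ N)⁻¹ := by gcongr
    _ = 2 * 2⁻¹ ^ N := by rw [ENNReal.inv_pow, mul_assoc, ← mul_pow, h4]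

/-- Negative moments of products of link bounds grow at most exponentially. -/
lemma ObservationSystem.lintegral_prod_rpow_neg_le
    (hobs : ObservationSystem P fs hs as bs₀ bs qs ψs μsm μsp gs X ζ Y ε A)
    {Z : (Euc p × Euc p) × ℝ → ℝ≥0∞} (hZ : Measurable Z) (hZ' : ∀ u, Z u ≠ ⊤) (t : ℝ) (i m : ℕ) :
    ∫⁻ ω, (∏ k ∈ Finset.range m, Z ((ε (i + k) ω, ε (i + k + 1) ω), A (i + k + 1) ω)) ^ (-t) ∂P ≤
      2 * (1 + ∫⁻ ω, Z ((ε 0 ω, ε 1 ω), A 1 ω) ^ (-(2 * t)) ∂P) ^ m := by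
  -- The maximum with `1` meets the requirement of the one-dependent bound; the square there doubles
  -- the exponent to `2 * t`.
  set Φ : (Euc p × Euc p) × ℝ → ℝ≥0∞ := fun u => max 1 (Z u ^ (-t))
  have hΦ : Measurable Φ := measurable_const.max (hZ.pow_const _)
  have hΦ2 : ∫⁻ ω, Φ ((ε 0 ω, ε 1 ω), A 1 ω) ^ 2 ∂P ≤
      1 + ∫⁻ ω, Z ((ε 0 ω, ε 1 ω), A 1 ω) ^ (-(2 * t)) ∂P := by
    calc _ ≤ ∫⁻ ω, (1 + Z ((ε 0 ω, ε 1 ω), A 1 ω) ^ (-(2 * t))) ∂P := by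
          refine lintegral_mono fun ω => (one_add_sq_max_le _).trans (le_of_eq ?_)
          rw [← ENNReal.rpow_natCast, ← ENNReal.rpow_mul]
          congr 2
          push_cast
          ring
      _ = _ := by rw [lintegral_add_left measurable_const]; simp
  calc _ ≤ ∫⁻ ω, ∏ k ∈ Finset.range m,
        Φ ((ε (i + k) ω, ε (i + k + 1) ω), A (i + k + 1) ω) ∂P := by
        refine lintegral_mono fun ω => ?_
        rw [← ENNReal.prod_rpow_of_ne_top fun _ _ => hZ' _]
        exact Finset.prod_le_prod' fun _ _ => le_max_right _ _
    _ ≤ _ := hobs.lintegral_prod_le hΦ (fun _ => le_max_left _ _) i m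
    _ ≤ _ := by gcongr

end Observations

end FilterForgetting

/-! ### Choice of the constants and integration -/

theorem proposition12 {n p : ℕ} (hpn : p ≤ n)
    -- the filtering model
    (f : Euc n → Euc n)
    (h : Euc n → Euc p)
    (v : Euc p → ℝ)
    (q : Euc n → Euc n → ℝ)
    (ψ : Euc n → ℝ) (a : ℝ≥0) (b₀ b μm μp : ℝ)
    (hE1 : CondE1 f h a b₀ b)
    (hE2 : CondE2 v)
    (hG : CondG q ψ μm μp)
    -- the process producing the observations
    {Ω : Type*} [MeasurableSpace Ω] (P : Measure Ω) [IsProbabilityMeasure P]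
    (fs : Euc n → Euc n)
    (hs : Euc n → Euc p)
    (as : ℝ≥0) (bs₀ bs : ℝ)
    (qs : Euc n → Euc n → ℝ)
    (ψs : Euc n → ℝ) (μsm μsp : ℝ)
    (gs : Euc n → ℝ → Euc n)
    (X ζ : ℕ → Ω → Euc n) (Y ε : ℕ → Ω → Euc p)
    (A : ℕ → Ω → ℝ)
    (hobs : ObservationSystem P fs hs as bs₀ bs qs ψs μsm μsp gs X ζ Y ε A)
    (hO1 : CondO1 f fs h hs)
    (gp : ℝ → ℝ) (hO3 : CondO3 gs gp)
    (hO4 : ∀ Δ : ℝ, 0 < Δ → ∃ τ : ℝ, 0 < τ ∧ ∀ t ∈ Set.Ico (0 : ℝ) τ,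
      logMGF P (fun ω => zStar μm ψ a b₀ b
        (kappa f fs h hs b₀ b as) as bs Δ (ε 0 ω) (ε 1 ω) (gp (A 1 ω))) t < ⊤)
    -- the two initial distributions
    (ν ν' : Measure (Euc n)) [IsProbabilityMeasure ν] [IsProbabilityMeasure ν']
    (Δ : ℝ) (hΔ : 0 < Δ)
    (hνν' : ∃ t : ℝ, 0 < t ∧
      negLogMoment P (fun ω => initialMass (stateKernel f q) (likelihood h v) ν
        (doeblinSet h (Y 1 ω) Δ) (Y 0 ω)) t < ⊤ ∧
      negLogMoment P (fun ω => initialMass (stateKernel f q) (likelihood h v) ν'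
        (doeblinSet h (Y 1 ω) Δ) (Y 0 ω)) t < ⊤) :
    limsup (fun N : ℕ => ENNReal.log (∫⁻ ω, tvDist
        (filterMeasure (stateKernel f q) (likelihood h v) ν N (fun k => Y k ω))
        (filterMeasure (stateKernel f q) (likelihood h v) ν' N (fun k => Y k ω)) ∂P)
          / ((N : ℝ) : EReal)) atTop < 0 := by
  -- In dimension zero the slope `b` may fail to be positive, but there is only one probability
  -- measure.
  rcases Nat.eq_zero_or_pos n with rfl | hn
  · have hνeq : ν = ν' := by
      refine Measure.ext fun s _ => ?_
      rcases Set.eq_empty_or_nonempty s with rfl | hne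
      · simp
      · rw [Set.eq_univ_of_forall fun x => Subsingleton.mem_iff_nonempty.2 hne, measure_univ,
          measure_univ]
    refine limsup_log_div_lt_zero (D := 0) (ρ := 0) ENNReal.zero_ne_top one_pos
      (Eventually.of_forall fun N => ?_)
    simp [hνeq, tvDist]
  have hb := hE1.slope_pos hn
  have hf : Measurable f := hE1.lipschitz.continuous.measurable
  have hh : Measurable h := hE1.uniformContinuous.continuous.measurable
  have hv : Measurable v := hE2.density.measurable
  have hq := hG.transition
  have hp := measurable_stateDensity hf hq.measurable
  have hp1 : ∀ x, ∫⁻ z, stateDensity f q x z ≤ 1 := fun x => (lintegral_stateDensity hq x).le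
  have hQ := stateKernel_apply hf hq.measurable
  have hMarkov := isMarkovKernel_stateKernel hf hq
  set Q := stateKernel f q
  set κ := kappa f fs h hs b₀ b as
  set δ : ℝ := (1 + as) * bs₀ / ((a + 1) * b)
  have hδ : 0 ≤ δ := by
    have := hobs.inv_const_pos
    positivity
  set l : ℝ → (Euc p × Euc p) × ℝ → ℝ≥0∞ := fun D =>
    linkBound μm ψ a b₀ b κ as bs gp (D + δ)
  have hl : ∀ D, Measurable (l D) := fun D =>
    measurable_linkBound hG hO3.measurable a b₀ b κ as bs (D + δ)
  have hl' : ∀ D u, l D u ≠ ⊤ := fun _ _ => ENNReal.ofReal_ne_top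
  have hlink := hobs.ae_linkBound_le hE1 hb hG hO1 hO3
  have hmom : ∀ D : ℝ, 0 < D → ∃ τ : ℝ, 0 < τ ∧ ∀ t ∈ Set.Ico (0 : ℝ) τ,
      ∫⁻ ω, l D ((ε 0 ω, ε 1 ω), A 1 ω) ^ (-t) ∂P < ⊤ := fun D hD => by
    obtain ⟨τ, hτ, hτ'⟩ := hO4 (D + δ) (by linarith)
    exact ⟨τ, hτ, fun t ht => (logMGF_zStar_lt_top_iff ..).1 (hτ' t ht)⟩
  -- constants that only depend on `Δ`
  obtain ⟨t₀, ht₀, hI, hJ⟩ := hνν'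
  obtain ⟨τ, hτ, hmomΔ⟩ := hmom Δ hΔ
  -- The factor `4` comes from the splitting in `min_one_ratio_le`, the further factor `2` from
  -- one-dependence of the link bounds.
  obtain ⟨s, hs0, hs1, hst, hsτ⟩ : ∃ s : ℝ, 0 < s ∧ s ≤ 1 ∧ 4 * s ≤ t₀ ∧ 2 * (4 * s) < τ := by
    refine ⟨min (min (t₀ / 4) (τ / 16)) 1, by positivity, min_le_right _ _, ?_, ?_⟩
    · linarith [(min_le_left (min (t₀ / 4) (τ / 16)) 1).trans (min_le_left _ _)]
    · linarith [(min_le_left (min (t₀ / 4) (τ / 16)) 1).trans (min_le_right _ _)]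
  set I : Ω → ℝ≥0∞ := fun ω =>
    initialMass Q (likelihood h v) ν (doeblinSet h (Y 1 ω) Δ) (Y 0 ω)
  set J : Ω → ℝ≥0∞ := fun ω =>
    initialMass Q (likelihood h v) ν' (doeblinSet h (Y 1 ω) Δ) (Y 0 ω)
  have hIm : Measurable I :=
    measurable_initialMass hh hv Q ν (hobs.measurable_Y 0) (hobs.measurable_Y 1) Δ
  have hJm : Measurable J :=
    measurable_initialMass hh hv Q ν' (hobs.measurable_Y 0) (hobs.measurable_Y 1) Δ
  have hI4 := lintegral_rpow_neg_lt_top hI (u := 4 * s) (by positivity) hst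
  have hJ4 := lintegral_rpow_neg_lt_top hJ (u := 4 * s) (by positivity) hst
  set K : ℝ≥0∞ := 1 + ∫⁻ ω, l Δ ((ε 0 ω, ε 1 ω), A 1 ω) ^ (-(2 * (4 * s))) ∂P
  have hK1 : 1 ≤ K := le_self_add
  have hK : K ≠ ⊤ := ENNReal.add_ne_top.2
    ⟨ENNReal.one_ne_top, (hmomΔ _ ⟨by positivity, hsτ⟩).ne⟩
  obtain ⟨w, hw, hw', hwv⟩ := exists_le_likelihood hE2 h Δ
  obtain ⟨c, hc, hc', hcv⟩ := exists_le_volume_doeblinSet hE1 hΔ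
  obtain ⟨V, hV, hV', hVθ⟩ := exists_likelihood_mul_exitWeight_le hE2 h
  set κ₀ := (V ^ 2 * (2 * V) ^ 2 * w⁻¹ ^ 2) ^ s
  set κ₁ := ((2 * V) ^ 2 * (w⁻¹ * c⁻¹) ^ 2) ^ s
  have hκ₀ : κ₀ ≠ ⊤ := ENNReal.rpow_ne_top_of_nonneg hs0.le (by finiteness)
  have hκ₁ : κ₁ ≠ ⊤ := ENNReal.rpow_ne_top_of_nonneg hs0.le (by finiteness)
  -- the exit weight, the coupling sets and the truncation level
  obtain ⟨θ, hθ1, hθ', hθK⟩ : ∃ θ : ℝ≥0∞, 1 ≤ θ ∧ θ ≠ ⊤ ∧ κ₁ * (θ ^ s)⁻¹ * K ≤ 2⁻¹ := by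
    -- `H` plays the role of `θ ^ s`, which must exceed twice the growth rate `κ₁ * K`.
    set H := max 1 (κ₁ * K * 2)
    have hH1 : 1 ≤ H := le_max_left _ _
    have hH : H ≠ ⊤ := (max_lt ENNReal.one_lt_top (by finiteness)).ne
    refine ⟨H ^ s⁻¹, ENNReal.one_le_rpow hH1 (by positivity),
      ENNReal.rpow_ne_top_of_nonneg (by positivity) hH, ?_⟩
    rw [← ENNReal.rpow_mul, inv_mul_cancel₀ hs0.ne', ENNReal.rpow_one, mul_right_comm,
      ← div_eq_mul_inv]
    refine ENNReal.div_le_of_le_mul ?_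
    calc κ₁ * K = κ₁ * K * 2 * 2⁻¹ := by
          rw [mul_assoc, ENNReal.mul_inv_cancel two_ne_zero ENNReal.ofNat_ne_top, mul_one]
      _ ≤ 2⁻¹ * H := by
          rw [mul_comm]
          gcongr
          exact le_max_right _ _
  have hθ0 : θ ≠ 0 := (one_pos.trans_le hθ1).ne'
  obtain ⟨D, hD, hVD⟩ := hVθ θ hθ0 hθ'
  obtain ⟨M, hM, hM', hMp⟩ := exists_lintegral_stateDensity_mul_exitWeight_le hf hG hθ0 hθ'
  obtain ⟨τ', hτ', hmomD⟩ := hmom D hD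
  have hlDm : Measurable fun ω => l D ((ε 0 ω, ε 1 ω), A 1 ω) := (hl D).comp
    (((hobs.measurable_ε 0).prodMk (hobs.measurable_ε 1)).prodMk (hobs.measurable_A 1))
  obtain ⟨c₀, hc₀, hc₀P⟩ := exists_level (P := P) hlDm (half_pos hτ')
    (hmomD _ ⟨(half_pos hτ').le, half_lt_self hτ'⟩) (η := (4 ^ 8)⁻¹)
    (ENNReal.inv_ne_zero.2 (by finiteness))
  obtain ⟨r, hr, hρ⟩ := exists_contraction (u := c₀ ^ 2 / M ^ 2)
    (ENNReal.div_ne_zero.2 ⟨pow_ne_zero _ hc₀, by finiteness⟩)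
  -- pathwise bound
  set u : ℕ → Ω → (Euc p × Euc p) × ℝ := fun k ω => ((ε k ω, ε (k + 1) ω), A (k + 1) ω)
  set T : ℕ → Ω → ℝ≥0∞ := fun N ω =>
    4 ^ (4 * inactiveCount (fun k => c₀ ≤ l D (u k ω)) 0 N) / 4 ^ N
  set Λ : ℕ → Ω → ℝ≥0∞ := fun m ω => ∏ i ∈ Finset.range m, l Δ (u (1 + i) ω)
  have hΛm : ∀ m, Measurable (Λ m) := fun m => Finset.measurable_prod _ fun i _ => (hl Δ).comp
    (((hobs.measurable_ε _).prodMk (hobs.measurable_ε _)).prodMk (hobs.measurable_A _))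
  have hpath : ∀ m, ∀ᵐ ω ∂P, tvDist (filterMeasure Q (likelihood h v) ν (m + 1) fun k => Y k ω)
      (filterMeasure Q (likelihood h v) ν' (m + 1) fun k => Y k ω) ≤
      T (m + 1) ω + (r ^ (m + 1) + κ₀ * (κ₁ * (θ ^ s)⁻¹) ^ m *
        (I ω ^ (-(4 * s)) + J ω ^ (-(4 * s)) + Λ m ω ^ (-(4 * s)))) := fun m => by
    filter_upwards [hlink] with ω hω
    -- Two radii are in play: `Δ`, fixed by the hypothesis on the initial laws, bounds the masses
    -- from below; `D`, depending on `θ`, defines the coupling.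
    have hlow := fun (ν : Measure (Euc n)) => initialMass_mul_le_unnormalizedFilter
      (g := likelihood h v) (y := fun k => Y k ω) (C := fun k => doeblinSet h (Y k ω) Δ)
      (l := fun k => l Δ (u k ω)) hp hQ (fun k => measurable_likelihood hh hv _)
      (fun k => measurableSet_doeblinSet hh _ _) (fun k => hwv _) (fun k => hcv _) (hω Δ) ν m
    have hI' : I ω ≠ ⊤ := likelihood_lintegral_ne_top hV' (fun x =>
      (le_mul_of_one_le_right' (one_le_pow₀ (one_le_exitWeight hθ1 _ _))).trans (hVD _ x)) Q ν _
    have hJ' : J ω ≠ ⊤ := likelihood_lintegral_ne_top hV' (fun x =>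
      (le_mul_of_one_le_right' (one_le_pow₀ (one_le_exitWeight hθ1 _ _))).trans (hVD _ x)) Q ν' _
    have hΛ' : Λ m ω ≠ ⊤ := ENNReal.prod_ne_top fun i _ => hl' Δ _
    have htv := tvDist_filterMeasure_le (g := likelihood h v) (y := fun k => Y k ω)
      (C := fun k => doeblinSet h (Y k ω) D) (act := fun k => c₀ ≤ l D (u k ω)) (c₀ := c₀) (t := 4)
      hp hp1 hQ (fun k => measurable_likelihood hh hv _) (fun k => measurableSet_doeblinSet hh _ _)
      hr.le (by norm_num) ENNReal.ofNat_ne_top hθ1 hθ' hV hV' (fun k => hVD _) hMp hM' hM hρ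
      (fun k hk x hx z hz => le_trans hk (hω D k x hx z hz)) ν ν' (m + 1) (hlow ν) (hlow ν')
    refine htv.trans ?_
    -- With the inactivity term in front, `lintegral_add_right` later asks for measurability of the
    -- remaining summands only.
    rw [add_comm (r ^ (m + 1)), add_assoc]
    gcongr
    exact min_one_ratio_le hs0 hs1 hw' hc' hθ1 hI' hJ' hΛ' m
  -- integration
  set S : ℝ≥0∞ := (∫⁻ ω, I ω ^ (-(4 * s)) ∂P) + (∫⁻ ω, J ω ^ (-(4 * s)) ∂P) + 2
  have hS : S ≠ ⊤ := by finiteness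
  have hrate : ∀ m, κ₀ * (κ₁ * (θ ^ s)⁻¹) ^ m *
      ((∫⁻ ω, I ω ^ (-(4 * s)) ∂P) + (∫⁻ ω, J ω ^ (-(4 * s)) ∂P) + 2 * K ^ m) ≤
      κ₀ * S * 2⁻¹ ^ m := fun m => by
    have h1 : 1 ≤ K ^ m := one_le_pow₀ hK1
    calc _ ≤ κ₀ * (κ₁ * (θ ^ s)⁻¹) ^ m * (S * K ^ m) := by
          gcongr
          simp only [S, add_mul]
          gcongr <;> exact le_mul_of_one_le_right' h1
      _ = κ₀ * S * (κ₁ * (θ ^ s)⁻¹ * K) ^ m := by rw [mul_pow _ K]; ring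
      _ ≤ _ := by gcongr
  have hint : ∀ m, ∫⁻ ω, tvDist (filterMeasure Q (likelihood h v) ν (m + 1) fun k => Y k ω)
      (filterMeasure Q (likelihood h v) ν' (m + 1) fun k => Y k ω) ∂P ≤
      2 * 2⁻¹ ^ (m + 1) + (r ^ (m + 1) + κ₀ * S * 2⁻¹ ^ m) := fun m => by
    have hmeas : Measurable fun ω => I ω ^ (-(4 * s)) + J ω ^ (-(4 * s)) + Λ m ω ^ (-(4 * s)) :=
      ((hIm.pow_const _).add (hJm.pow_const _)).add ((hΛm m).pow_const _)
    refine (lintegral_mono_ae (hpath m)).trans ?_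
    rw [lintegral_add_right _ ((hmeas.const_mul _).const_add _),
      lintegral_add_left measurable_const, lintegral_const_mul _ hmeas,
      lintegral_add_right _ ((hΛm m).pow_const _), lintegral_add_right _ (hJm.pow_const _),
      lintegral_const, measure_univ, mul_one]
    refine add_le_add (hobs.lintegral_pow_inactiveCount_le (hl D) hc₀P (m + 1))
      (add_le_add le_rfl (le_trans ?_ (hrate m)))
    gcongr
    exact hobs.lintegral_prod_rpow_neg_le (hl Δ) (hl' Δ) (4 * s) 1 m
  -- The last factor `2` in `D` comes from passing from `m` to `N = m + 1`.
  refine limsup_log_div_lt_zero (D := 2 + (1 + κ₀ * S * 2)) (ρ := max r 2⁻¹) (by finiteness)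
    (max_lt hr (by norm_num)) ?_
  filter_upwards [eventually_gt_atTop 0] with N hN
  obtain ⟨m, rfl⟩ := Nat.exists_eq_succ_of_ne_zero hN.ne'
  refine (hint m).trans ?_
  have h1 : (2⁻¹ : ℝ≥0∞) ^ m = 2 * 2⁻¹ ^ (m + 1) := by
    rw [pow_succ', ← mul_assoc, ENNReal.mul_inv_cancel two_ne_zero ENNReal.ofNat_ne_top, one_mul]
  rw [h1, add_mul, add_mul, one_mul, ← mul_assoc (κ₀ * S)]
  gcongr
  · exact le_max_right _ _
  · exact le_max_left _ _
  · exact le_max_right _ _
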